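/- Let $d$ be a nonnegative integer, let $\sigma>0$ and $C_{\mathrm{SG}}\in\mathbb R$, and let $\mu$ be a probability measure on $\mathbb R^d$ such that $$\iint \exp\Bigl(\frac{\|x-x'\|^2}{\sigma^2}\Bigr)\,d\mu(x)\,d\mu(x')\le C_{\mathrm{SG}} .$$ Let $t>\sigma^2$ and let $\gamma_{0,t}$ be the centered Gaussian measure on $\mathbb R^d$ with covariance matrix $tI_d$. Let $C_b^\infty(\mathbb R^d)$ be the set of infinitely differentiable functions $f:\mathbb R^d\to\mathbb R$ that are bounded together with all their derivatives. For a probability measure $\rho$ on $\mathbb R^d$, let $C_{\mathrm P}(\rho)\in[0,\infty]$ be the infimum of the constants $C\ge 0$ such that $$\operatorname{var}_\rho(f)\le C\,\int\|\nabla f\|^2\,d\rho\qquad\text{for all } f\in C_b^\infty(\mathbb R^d),\tag{PI}$$ and let $C_{\mathrm{LS}}(\rho)\in[0,\infty]$ be the infimum of the constants $C\ge 0$ such that $$\int f^2\log (f^2)\,d\rho-\Bigl(\int f^2\,d\rho\Bigr)\log\Bigl(\int f^2\,d\rho\Bigr)\le 2C\int\|\nabla f\|^2\,d\rho\qquad\text{for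 all } f\in C_b^\infty(\mathbb R^d),\tag{LSI}$$ where $0\log 0=0$ and $\inf\varnothing=\infty$. Then the convolution $\mu*\gamma_{0,t}$ satisfies both (PI) and (LSI) with finite constants, and $$C_{\mathrm P}(\mu*\gamma_{0,t})\le t\,\Bigl\{\frac{t}{t-\sigma^2}+C_{\mathrm{SG}}^{\sigma^2/(t-\sigma^2)}\Bigr\},$$ $$C_{\mathrm{LS}}(\mu*\gamma_{0,t})\le 3t\,\Bigl\{\frac{t}{t-\sigma^2}+C_{\mathrm{SG}}^{\sigma^2/(t-\sigma^2)}\Bigr\}\Bigl\{1+\frac{\sigma^2}{t-\sigma^2}\log C_{\mathrm{SG}}\Bigr\}.$$ -/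

import Mathlib

open MeasureTheory ProbabilityTheory
open scoped ENNReal NNReal ContDiff Gradient

noncomputable section

namespace GaussConv

/-- Euclidean space `ℝ^d`. -/
abbrev Space (d : ℕ) : Type := EuclideanSpace ℝ (Fin d)

/-- The class `C_b^∞(ℝ^d)` of test functions: infinitely differentiable functions which are bounded
and all of whose derivatives are bounded (order `n = 0` is the boundedness of `f` itself). -/
def IsTest {d : ℕ} (f : Space d → ℝ) : Prop :=
  ContDiff ℝ ∞ f ∧ ∀ n : ℕ, ∃ B : ℝ, ∀ x, ‖iteratedFDeriv ℝ n f x‖ ≤ B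

/-- The Dirichlet energy `E_ρ ‖∇f‖²`. -/
def energy {d : ℕ} (ρ : Measure (Space d)) (f : Space d → ℝ) : ℝ :=
  ∫ x, ‖∇ f x‖ ^ 2 ∂ρ

/-- The entropy `ent_ρ(g) = E_ρ(g log g) - E_ρ g log E_ρ g`. -/
def ent {d : ℕ} (ρ : Measure (Space d)) (g : Space d → ℝ) : ℝ :=
  (∫ x, g x * Real.log (g x) ∂ρ) - (∫ x, g x ∂ρ) * Real.log (∫ x, g x ∂ρ)

/-- The Poincaré inequality for `ρ` with constant `C`. -/
def PI {d : ℕ} (ρ : Measure (Space d)) (C : ℝ) : Prop :=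
  ∀ f : Space d → ℝ, IsTest f → variance f ρ ≤ C * energy ρ f

/-- The logarithmic Sobolev inequality for `ρ` with constant `C`. -/
def LSI {d : ℕ} (ρ : Measure (Space d)) (C : ℝ) : Prop :=
  ∀ f : Space d → ℝ, IsTest f → ent ρ (fun x => f x ^ 2) ≤ 2 * C * energy ρ f

/-- The optimal constant `C_P(ρ)` in the Poincaré inequality (`∞` if the inequality fails for
every constant). -/
def poincareConst {d : ℕ} (ρ : Measure (Space d)) : ℝ≥0∞ :=
  ⨅ (C : ℝ≥0) (_ : PI ρ C), (C : ℝ≥0∞)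

/-- The optimal constant `C_LS(ρ)` in the logarithmic Sobolev inequality (`∞` if the inequality
fails for every constant). -/
def logSobolevConst {d : ℕ} (ρ : Measure (Space d)) : ℝ≥0∞ :=
  ⨅ (C : ℝ≥0) (_ : LSI ρ C), (C : ℝ≥0∞)

/-- The centered Gaussian measure on `ℝ^d` with covariance matrix `t I_d`. -/
def gaussian (d : ℕ) (t : ℝ) : Measure (Space d) :=
  multivariateGaussian 0 (t • (1 : Matrix (Fin d) (Fin d) ℝ))

/-- The sub-Gaussian tail condition
`∬ exp(‖x - x'‖² / σ²) dμ(x) dμ(x') ≤ C`; the left-hand side is an element of `[0, ∞]`. -/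
def SubGaussianTails {d : ℕ} (μ : Measure (Space d)) (σ C : ℝ) : Prop :=
  ∫⁻ x, ∫⁻ x', ENNReal.ofReal (Real.exp (‖x - x'‖ ^ 2 / σ ^ 2)) ∂μ ∂μ ≤ ENNReal.ofReal C

end GaussConv

end

/-! The measure `μ * γ_{0,t}` is the mixture over `x ∼ μ` of the Gaussians `N(x, tI)`. Each
component satisfies (PI) and (LSI) with constant `t`, so only the spread between components has to
be controlled. Write `u(x)` for the mean of the test function under component `x`.

Poincaré. The variance is the mean of the component variances `a(x)` plus `v = var_μ(u)`. By
Cameron–Martin, two components have χ²-divergence `exp(‖x-x'‖²/t) - 1`, so Cauchy–Schwarz gives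
`(u(x)-u(x'))² ≤ a(x')(exp(‖x-x'‖²/t) - 1)`. Integrating in `x`, and then in `x'` by Cauchy–Schwarz,
yields `v ≤ (M-1) ∫ a dμ`, where `M = ∬ exp(‖x-x'‖²/t)`. Jensen gives `M ≤ C_SG^{σ²/t}`, whence (PI)
with constant `t C_SG^{σ²/t}` (`poincare_conv`).

Log-Sobolev. The entropy of `F` is the mean of the component entropies `e(x)` plus `J = ent_μ(u)`. A
Harnack-type bound (`mul_log_div_le`) gives `u(x) log(u(x)/u(x')) ≤ e(x) + u(x)‖x-x'‖²/t`. After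
averaging, the transport-like term is controlled by entropy duality against `exp(‖x-x'‖²/σ²)`, at
the price of `(σ²/t) J`. Since `σ² < t`, this is absorbed on the left, leaving a defective
inequality (`defective_log_sobolev_conv`). A Rothaus-type lemma (`ent_sq_const_add_le`) reduces to
centred functions, where Poincaré removes the defect.

The inequalities for one Gaussian come from differentiating `∫ Φ(P_θ g)` along the
Ornstein–Uhlenbeck rotation (`integral_comp_sub_le_stdGaussian`). -/

namespace GaussConv

open Filter Topology Set Matrix

/-! ### Rotation invariance and Gaussian integration by parts. -/

section StdGaussian

variable {E : Type*} [NormedAddCommGroup E] [InnerProductSpace ℝ E]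

lemma norm_cos_smul_add_sin_smul_le (θ : ℝ) (x y : E) :
    ‖Real.cos θ • x + Real.sin θ • y‖ ≤ ‖x‖ + ‖y‖ := by
  refine (norm_add_le _ _).trans (add_le_add ?_ ?_)
  · rw [norm_smul]
    exact mul_le_of_le_one_left (norm_nonneg _) (Real.abs_cos_le_one θ)
  · rw [norm_smul]
    exact mul_le_of_le_one_left (norm_nonneg _) (Real.abs_sin_le_one θ)

lemma norm_neg_sin_smul_add_cos_smul_le (θ : ℝ) (x y : E) :
    ‖-Real.sin θ • x + Real.cos θ • y‖ ≤ ‖x‖ + ‖y‖ := by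
  refine (norm_add_le _ _).trans (add_le_add ?_ ?_)
  · rw [norm_smul, norm_neg]
    exact mul_le_of_le_one_left (norm_nonneg _) (Real.abs_sin_le_one θ)
  · rw [norm_smul]
    exact mul_le_of_le_one_left (norm_nonneg _) (Real.abs_cos_le_one θ)

lemma hasDerivAt_cos_smul_add_sin_smul (x y : E) (θ : ℝ) :
    HasDerivAt (fun θ : ℝ => Real.cos θ • x + Real.sin θ • y)
      (-Real.sin θ • x + Real.cos θ • y) θ :=
  ((Real.hasDerivAt_cos θ).smul_const x).add ((Real.hasDerivAt_sin θ).smul_const y)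

lemma hasDerivAt_neg_sin_smul_add_cos_smul (x y : E) (θ : ℝ) :
    HasDerivAt (fun θ : ℝ => -Real.sin θ • x + Real.cos θ • y)
      (-(Real.cos θ • x + Real.sin θ • y)) θ := by
  have := ((Real.hasDerivAt_sin θ).neg.smul_const x).add ((Real.hasDerivAt_cos θ).smul_const y)
  refine this.congr_deriv ?_
  simp only [neg_smul, neg_add_rev]
  abel

variable [FiniteDimensional ℝ E] [MeasurableSpace E] [BorelSpace E]

lemma integral_rotation_stdGaussian (θ : ℝ) {F : E × E → ℝ} (hF : Continuous F) :
    ∫ p : E × E, F (Real.cos θ • p.1 + Real.sin θ • p.2, -Real.sin θ • p.1 + Real.cos θ • p.2)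
        ∂(stdGaussian E).prod (stdGaussian E)
      = ∫ p, F p ∂(stdGaussian E).prod (stdGaussian E) := by
  have h := IsGaussian.map_rotation_eq_self (μ := stdGaussian E) (by simp) θ
  conv_rhs => rw [← h]
  rw [integral_map (by fun_prop) hF.aestronglyMeasurable]
  rfl

lemma integrable_norm_stdGaussian : Integrable (fun x : E => ‖x‖) (stdGaussian E) :=
  (IsGaussian.integrable_id (μ := stdGaussian E)).norm

lemma integrable_norm_sq_stdGaussian : Integrable (fun x : E => ‖x‖ ^ 2) (stdGaussian E) :=
  (IsGaussian.memLp_id (stdGaussian E) 2 (by norm_num)).integrable_norm_pow (by norm_num)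

lemma integrable_norm_sq_prod_stdGaussian :
    Integrable (fun p : E × E => 1 + ‖p.1‖ ^ 2 + ‖p.2‖ ^ 2)
      ((stdGaussian E).prod (stdGaussian E)) := by
  refine ((integrable_const _).add ?_).add ?_
  · exact (integrable_norm_sq_stdGaussian (E := E)).comp_fst _
  · exact (integrable_norm_sq_stdGaussian (E := E)).comp_snd _

lemma integral_inner_mul_inner_stdGaussian (a b : E) :
    ∫ w, inner ℝ a w * inner ℝ b w ∂stdGaussian E = inner ℝ a b := by
  have h := covarianceBilin_apply (μ := stdGaussian E)
    (IsGaussian.memLp_id _ 2 (by norm_num)) a b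
  rw [covarianceBilin_stdGaussian] at h
  simp only [id_eq, integral_id_stdGaussian, sub_zero] at h
  exact h.symm

/-- Gaussian integration by parts. -/
lemma integral_mul_inner_stdGaussian {F : E → ℝ} {F' : E → E →L[ℝ] ℝ} {K : ℝ}
    (hF : ∀ v, HasFDerivAt F (F' v) v) (hF' : Continuous F') (hK : ∀ v, |F v| ≤ K)
    (hK' : ∀ v, ‖F' v‖ ≤ K) (a : E) :
    ∫ v, F v * inner ℝ a v ∂stdGaussian E = ∫ v, F' v a ∂stdGaussian E := by
  have hK0 : 0 ≤ K := (abs_nonneg _).trans (hK 0)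
  have hFc : Continuous F := continuous_iff_continuousAt.2 fun v => (hF v).continuousAt
  set Γ := (stdGaussian E).prod (stdGaussian E)
  -- By rotation invariance `∫ H θ` does not depend on `θ`. Its derivative at `0` is `E[F'(x)y
  -- ⟨a,y⟩] - E[F(x)⟨a,x⟩]`, and averaging over `y` with identity covariance turns the first term
  -- into `E[F'(x)a]`.
  set H : ℝ → E × E → ℝ := fun θ p =>
    F (Real.cos θ • p.1 + Real.sin θ • p.2) *
      inner ℝ a (-Real.sin θ • p.1 + Real.cos θ • p.2) with hH
  set H' : ℝ → E × E → ℝ := fun θ p =>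
    F' (Real.cos θ • p.1 + Real.sin θ • p.2) (-Real.sin θ • p.1 + Real.cos θ • p.2) *
      inner ℝ a (-Real.sin θ • p.1 + Real.cos θ • p.2) +
    F (Real.cos θ • p.1 + Real.sin θ • p.2) *
      inner ℝ a (-(Real.cos θ • p.1 + Real.sin θ • p.2)) with hH'
  have hHc : ∀ θ, Continuous (H θ) := fun θ => by
    simp only [hH]; fun_prop
  have hH'c : ∀ θ, Continuous (H' θ) := fun θ => by
    simp only [hH']; fun_prop
  have hbd : ∀ θ p, ‖H θ p‖ ≤ K * ‖a‖ * (1 + ‖p.1‖ ^ 2 + ‖p.2‖ ^ 2) := by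
    intro θ p
    have h1 := hK (Real.cos θ • p.1 + Real.sin θ • p.2)
    have h2 := (abs_real_inner_le_norm a (-Real.sin θ • p.1 + Real.cos θ • p.2)).trans
      (mul_le_mul_of_nonneg_left (norm_neg_sin_smul_add_cos_smul_le θ p.1 p.2) (norm_nonneg a))
    simp only [hH, norm_mul, Real.norm_eq_abs]
    calc _ ≤ K * (‖a‖ * (‖p.1‖ + ‖p.2‖)) := mul_le_mul h1 h2 (abs_nonneg _) hK0
      _ = K * ‖a‖ * (‖p.1‖ + ‖p.2‖) := by ring
      _ ≤ _ := by
        refine mul_le_mul_of_nonneg_left ?_ (by positivity)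
        nlinarith [sq_nonneg (‖p.1‖ - 1 / 2), sq_nonneg (‖p.2‖ - 1 / 2)]
  have hbd' : ∀ θ p, ‖H' θ p‖ ≤ 3 * K * ‖a‖ * (1 + ‖p.1‖ ^ 2 + ‖p.2‖ ^ 2) := by
    intro θ p
    have h1 := hK (Real.cos θ • p.1 + Real.sin θ • p.2)
    have h3 := ((F' (Real.cos θ • p.1 + Real.sin θ • p.2)).le_opNorm
      (-Real.sin θ • p.1 + Real.cos θ • p.2)).trans (mul_le_mul (hK' _)
        (norm_neg_sin_smul_add_cos_smul_le θ p.1 p.2) (norm_nonneg _) hK0)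
    have h2 := (abs_real_inner_le_norm a (-Real.sin θ • p.1 + Real.cos θ • p.2)).trans
      (mul_le_mul_of_nonneg_left (norm_neg_sin_smul_add_cos_smul_le θ p.1 p.2) (norm_nonneg a))
    have h4 := (abs_real_inner_le_norm a (-(Real.cos θ • p.1 + Real.sin θ • p.2))).trans
      (mul_le_mul_of_nonneg_left ((norm_neg _).trans_le
        (norm_cos_smul_add_sin_smul_le θ p.1 p.2)) (norm_nonneg a))
    refine (norm_add_le _ _).trans ?_
    rw [norm_mul, norm_mul]
    calc _ ≤ (K * (‖p.1‖ + ‖p.2‖)) * (‖a‖ * (‖p.1‖ + ‖p.2‖)) + K * (‖a‖ * (‖p.1‖ + ‖p.2‖)) := by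
          refine add_le_add (mul_le_mul h3 h2 (norm_nonneg _) (by positivity))
            (mul_le_mul h1 h4 (norm_nonneg _) hK0)
      _ = K * ‖a‖ * ((‖p.1‖ + ‖p.2‖) ^ 2 + (‖p.1‖ + ‖p.2‖)) := by ring
      _ ≤ K * ‖a‖ * (3 * (1 + ‖p.1‖ ^ 2 + ‖p.2‖ ^ 2)) := by
        refine mul_le_mul_of_nonneg_left ?_ (by positivity)
        nlinarith [sq_nonneg (‖p.1‖ - ‖p.2‖), sq_nonneg (‖p.1‖ - 1 / 2), sq_nonneg (‖p.2‖ - 1 / 2)]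
      _ = _ := by ring
  have hHi : ∀ θ, Integrable (H θ) Γ := fun θ =>
    (integrable_norm_sq_prod_stdGaussian.const_mul _).mono' (hHc θ).aestronglyMeasurable
      (ae_of_all _ (hbd θ))
  have hder := (hasDerivAt_integral_of_dominated_loc_of_deriv_le (μ := Γ) (F := H) (F' := H')
    (x₀ := (0 : ℝ)) (s := univ) univ_mem
    (Eventually.of_forall fun θ => (hHc θ).aestronglyMeasurable) (hHi 0)
    (hH'c 0).aestronglyMeasurable (ae_of_all _ fun p θ _ => hbd' θ p)
    (integrable_norm_sq_prod_stdGaussian.const_mul _)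
    (ae_of_all _ fun p θ _ => by
      have e1 := (hF (Real.cos θ • p.1 + Real.sin θ • p.2)).comp_hasDerivAt θ
        (hasDerivAt_cos_smul_add_sin_smul p.1 p.2 θ)
      have e2 := (innerSL ℝ a).hasFDerivAt.comp_hasDerivAt θ
        (hasDerivAt_neg_sin_smul_add_cos_smul p.1 p.2 θ)
      exact e1.mul e2))
  have hconst : ∀ θ, ∫ p, H θ p ∂Γ = ∫ p : E × E, F p.1 * inner ℝ a p.2 ∂Γ := fun θ =>
    integral_rotation_stdGaussian θ (F := fun p : E × E => F p.1 * inner ℝ a p.2) (by fun_prop)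
  have h0 : ∫ p, H' 0 p ∂Γ = 0 := by
    refine hder.2.unique ?_
    simp_rw [hconst]
    exact hasDerivAt_const _ _
  have hi1 : Integrable (fun p : E × E => F' p.1 p.2 * inner ℝ a p.2) Γ := by
    refine (integrable_norm_sq_prod_stdGaussian.const_mul (K * ‖a‖)).mono'
      (by fun_prop) (ae_of_all _ fun p => ?_)
    rw [norm_mul]
    calc _ ≤ (K * ‖p.2‖) * (‖a‖ * ‖p.2‖) := by
          refine mul_le_mul (((F' p.1).le_opNorm _).trans ?_) (abs_real_inner_le_norm _ _)
            (norm_nonneg _) (by positivity)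
          exact mul_le_mul_of_nonneg_right (hK' _) (norm_nonneg _)
      _ = K * ‖a‖ * ‖p.2‖ ^ 2 := by ring
      _ ≤ _ := mul_le_mul_of_nonneg_left (by nlinarith [sq_nonneg ‖p.1‖]) (by positivity)
  have hi2 : Integrable (fun v : E => F v * inner ℝ a v) (stdGaussian E) := by
    refine (integrable_norm_stdGaussian.const_mul (K * ‖a‖)).mono'
      (by fun_prop) (ae_of_all _ fun v => ?_)
    rw [norm_mul, mul_assoc]
    exact mul_le_mul (hK _) (abs_real_inner_le_norm _ _) (norm_nonneg _) hK0
  have hH0 : H' 0 = fun p => F' p.1 p.2 * inner ℝ a p.2 - F p.1 * inner ℝ a p.1 := by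
    ext p; simp [hH']; ring
  rw [hH0, integral_sub hi1 (hi2.comp_fst _), integral_prod _ hi1,
    integral_fun_fst (fun v => F v * inner ℝ a v)] at h0
  have hin : ∀ v, ∫ w, F' v w * inner ℝ a w ∂stdGaussian E = F' v a := fun v => by
    have h := integral_inner_mul_inner_stdGaussian ((InnerProductSpace.toDual ℝ E).symm (F' v)) a
    simpa using h
  simp_rw [hin] at h0
  simp at h0
  linarith

end StdGaussian

/-! ### Ornstein–Uhlenbeck interpolation and its dissipation. -/

section Interpolation

variable {E : Type*} [NormedAddCommGroup E] [InnerProductSpace ℝ E] [FiniteDimensional ℝ E]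

/-- Continuously differentiable functions bounded by `K` together with their gradient. -/
structure BddC1 (g : E → ℝ) (K : ℝ) : Prop where
  hasFDerivAt : ∀ x, HasFDerivAt g (innerSL ℝ (∇ g x)) x
  continuous_grad : Continuous (∇ g)
  bound : ∀ x, |g x| ≤ K
  bound_grad : ∀ x, ‖∇ g x‖ ≤ K

lemma BddC1.continuous {g : E → ℝ} {K : ℝ} (hg : BddC1 g K) : Continuous g :=
  continuous_iff_continuousAt.2 fun x => (hg.hasFDerivAt x).continuousAt

lemma BddC1.nonneg {g : E → ℝ} {K : ℝ} (hg : BddC1 g K) : 0 ≤ K :=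
  (abs_nonneg _).trans (hg.bound 0)

variable [MeasurableSpace E] [BorelSpace E]

/-- The Ornstein-Uhlenbeck averages `x ↦ ∫ g (cos θ x + sin θ y) dγ(y)`. -/
noncomputable def mehler {V : Type*} [NormedAddCommGroup V] [NormedSpace ℝ V] (θ : ℝ)
    (g : E → V) (x : E) : V :=
  ∫ y, g (Real.cos θ • x + Real.sin θ • y) ∂stdGaussian E

lemma integrable_of_continuous_of_bound {α V : Type*} [TopologicalSpace α] [MeasurableSpace α]
    [OpensMeasurableSpace α] [NormedAddCommGroup V] [SecondCountableTopology V]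
    {ν : Measure α} [IsFiniteMeasure ν]
    {f : α → V} {K : ℝ} (hf : Continuous f) (hK : ∀ x, ‖f x‖ ≤ K) : Integrable f ν :=
  Integrable.of_bound hf.aestronglyMeasurable K (ae_of_all _ hK)

section

lemma integrable_mehler {V : Type*} [NormedAddCommGroup V] [SecondCountableTopology V]
    {g : E → V} {K : ℝ} (hg : Continuous g) (hK : ∀ x, ‖g x‖ ≤ K) (θ : ℝ) (x : E) :
    Integrable (fun y => g (Real.cos θ • x + Real.sin θ • y)) (stdGaussian E) :=
  integrable_of_continuous_of_bound (by fun_prop) fun _ => hK _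

variable {V : Type*} [NormedAddCommGroup V] [NormedSpace ℝ V]

lemma norm_mehler_le {g : E → V} {K : ℝ} (hK : ∀ x, ‖g x‖ ≤ K) (θ : ℝ) (x : E) :
    ‖mehler θ g x‖ ≤ K := by
  rw [mehler]
  simpa using norm_integral_le_of_norm_le_const (μ := stdGaussian E) (ae_of_all _ fun y =>
    hK (Real.cos θ • x + Real.sin θ • y))

lemma continuous_mehler [SecondCountableTopology V] {g : E → V} {K : ℝ} (hg : Continuous g)
    (hK : ∀ x, ‖g x‖ ≤ K) (θ : ℝ) :
    Continuous (mehler θ g) :=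
  continuous_of_dominated (bound := fun _ => K)
    (fun x => (Continuous.aestronglyMeasurable (by fun_prop)))
    (fun x => ae_of_all _ fun y => hK _) (integrable_const _) (ae_of_all _ fun y => by fun_prop)

end

lemma mehler_mem_Icc {g : E → ℝ} {m M : ℝ} (hg : Continuous g) (hm : ∀ x, g x ∈ Icc m M)
    (θ : ℝ) (x : E) : mehler θ g x ∈ Icc m M := by
  have hi : Integrable (fun y => g (Real.cos θ • x + Real.sin θ • y)) (stdGaussian E) :=
    integrable_mehler (K := max |m| |M|) hg (fun x => abs_le_max_abs_abs (hm x).1 (hm x).2) θ x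
  rw [mehler]
  constructor
  · simpa using integral_mono (integrable_const m) hi fun y => (hm _).1
  · simpa using integral_mono hi (integrable_const M) fun y => (hm _).2

lemma hasFDerivAt_mehler {g : E → ℝ} {K : ℝ} (hg : BddC1 g K) (θ : ℝ) (x : E) :
    HasFDerivAt (mehler θ g) (Real.cos θ • innerSL ℝ (mehler θ (∇ g) x)) x := by
  have hc := hg.continuous
  have hc' := hg.continuous_grad
  have h := hasFDerivAt_integral_of_dominated_of_fderiv_le (μ := stdGaussian E)
    (F := fun x y => g (Real.cos θ • x + Real.sin θ • y))
    (F' := fun x y => Real.cos θ • innerSL ℝ (∇ g (Real.cos θ • x + Real.sin θ • y)))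
    (x₀ := x) (s := univ) (bound := fun _ => K) univ_mem
    (Eventually.of_forall fun x => Continuous.aestronglyMeasurable (by fun_prop))
    (integrable_mehler hc hg.bound θ x)
    (Continuous.aestronglyMeasurable (by fun_prop))
    (ae_of_all _ fun y x _ => by
      rw [norm_smul, innerSL_apply_norm]
      exact (mul_le_of_le_one_left (norm_nonneg _) (Real.abs_cos_le_one θ)).trans
        (hg.bound_grad _))
    (integrable_const _)
    (ae_of_all _ fun y x _ => by
      have e1 : HasFDerivAt (fun x : E => Real.cos θ • x + Real.sin θ • y)
          (Real.cos θ • ContinuousLinearMap.id ℝ E) x :=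
        ((hasFDerivAt_id x).const_smul (Real.cos θ)).add_const _
      refine ((hg.hasFDerivAt _).comp x e1).congr_fderiv ?_
      ext v; simp)
  refine h.congr_fderiv ?_
  rw [integral_smul, ContinuousLinearMap.integral_comp_comm (innerSL ℝ)
    (integrable_mehler hc' hg.bound_grad θ x)]
  rfl

lemma hasDerivAt_mehler {g : E → ℝ} {K : ℝ} (hg : BddC1 g K) (θ : ℝ) (x : E) :
    HasDerivAt (fun θ => mehler θ g x)
      (∫ y, inner ℝ (∇ g (Real.cos θ • x + Real.sin θ • y))
        (-Real.sin θ • x + Real.cos θ • y) ∂stdGaussian E) θ := by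
  have hc := hg.continuous
  have hc' := hg.continuous_grad
  exact (hasDerivAt_integral_of_dominated_loc_of_deriv_le (μ := stdGaussian E)
    (F := fun θ y => g (Real.cos θ • x + Real.sin θ • y))
    (F' := fun θ y => inner ℝ (∇ g (Real.cos θ • x + Real.sin θ • y))
        (-Real.sin θ • x + Real.cos θ • y))
    (x₀ := θ) (s := univ) (bound := fun y => K * (‖x‖ + ‖y‖)) univ_mem
    (Eventually.of_forall fun x => Continuous.aestronglyMeasurable (by fun_prop))
    (integrable_mehler hc hg.bound θ x)
    (Continuous.aestronglyMeasurable (by fun_prop))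
    (ae_of_all _ fun y θ _ => (norm_inner_le_norm _ _).trans (mul_le_mul (hg.bound_grad _)
      (norm_neg_sin_smul_add_cos_smul_le θ x y) (norm_nonneg _) hg.nonneg))
    (((integrable_const _).add integrable_norm_stdGaussian).const_mul _)
    (ae_of_all _ fun y θ _ => (hg.hasFDerivAt _).comp_hasDerivAt θ
      (hasDerivAt_cos_smul_add_sin_smul x y θ))).2

/-- The first coordinate of a rotated pair of independent standard Gaussians is again standard
Gaussian. -/
lemma integral_mehler {g : E → ℝ} {K : ℝ} (hg : Continuous g) (hK : ∀ x, ‖g x‖ ≤ K) (θ : ℝ) :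
    ∫ x, mehler θ g x ∂stdGaussian E = ∫ x, g x ∂stdGaussian E := by
  have h := integral_rotation_stdGaussian (E := E) θ (F := fun p => g p.1) (by fun_prop)
  rw [integral_fun_fst, integral_prod] at h
  · simpa [mehler] using h
  · exact integrable_of_continuous_of_bound (by fun_prop) fun _ => hK _

/-- The dissipation identity along the Ornstein-Uhlenbeck interpolation. -/
lemma integral_deriv_mehler {g : E → ℝ} {K m M : ℝ} (hg : BddC1 g K)
    (hm : ∀ x, g x ∈ Icc m M) {φ φ' : ℝ → ℝ} (hφ : ∀ u ∈ Icc m M, HasDerivAt φ (φ' u) u)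
    (hφ' : ContinuousOn φ' (Icc m M)) (θ : ℝ) :
    ∫ x, φ (mehler θ g x) * ∫ y, inner ℝ (∇ g (Real.cos θ • x + Real.sin θ • y))
        (-Real.sin θ • x + Real.cos θ • y) ∂stdGaussian E ∂stdGaussian E =
      -(Real.sin θ * Real.cos θ) *
        ∫ x, φ' (mehler θ g x) * ‖mehler θ (∇ g) x‖ ^ 2 ∂stdGaussian E := by
  have hc := hg.continuous
  have hc' := hg.continuous_grad
  have hK0 := hg.nonneg
  have hφc : ContinuousOn φ (Icc m M) := fun u hu => (hφ u hu).continuousAt.continuousWithinAt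
  have hPm := mehler_mem_Icc hc hm θ
  have hPc := continuous_mehler hc hg.bound θ
  have hPc' := continuous_mehler hc' hg.bound_grad θ
  have hφP : Continuous fun x => φ (mehler θ g x) := hφc.comp_continuous hPc hPm
  have hφP' : Continuous fun x => φ' (mehler θ g x) := hφ'.comp_continuous hPc hPm
  obtain ⟨A, hA⟩ := isCompact_Icc.exists_bound_of_continuousOn hφc
  obtain ⟨A', hA'⟩ := isCompact_Icc.exists_bound_of_continuousOn hφ'
  have hA0 : 0 ≤ A := (norm_nonneg _).trans (hA _ (hm 0))
  have hA'0 : 0 ≤ A' := (norm_nonneg _).trans (hA' _ (hm 0))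
  have hrotc : Continuous fun p : E × E => Real.cos θ • p.1 - Real.sin θ • p.2 := by fun_prop
  have hφR := hφP.comp hrotc
  have hφR' := hφP'.comp hrotc
  have hPR' := hPc'.comp hrotc
  have hφF := hφP.comp (continuous_fst (X := E) (Y := E))
  have hφF' := hφP'.comp (continuous_fst (X := E) (Y := E))
  have hPF' := hPc'.comp (continuous_fst (X := E) (Y := E))
  simp only [Function.comp_def] at hφR hφR' hPR' hφF hφF' hPF'
  set Γ := (stdGaussian E).prod (stdGaussian E)
  have hi : Integrable (fun p : E × E => φ (mehler θ g (Real.cos θ • p.1 - Real.sin θ • p.2)) *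
      inner ℝ (∇ g p.1) p.2) Γ := by
    refine ((integrable_norm_stdGaussian (E := E)).comp_snd _ |>.const_mul (A * K)).mono'
      (hφR.mul (by fun_prop)).aestronglyMeasurable (ae_of_all _ fun p => ?_)
    rw [norm_mul, mul_assoc]
    exact mul_le_mul (hA _ (hPm _)) ((norm_inner_le_norm _ _).trans
      (mul_le_mul_of_nonneg_right (hg.bound_grad _) (norm_nonneg _))) (norm_nonneg _) hA0
  have hi' : Integrable (fun p : E × E =>
      φ (mehler θ g p.1) * inner ℝ (∇ g (Real.cos θ • p.1 + Real.sin θ • p.2))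
        (-Real.sin θ • p.1 + Real.cos θ • p.2)) Γ := by
    have hb := ((integrable_norm_stdGaussian (E := E)).comp_fst (stdGaussian E)).add
      ((integrable_norm_stdGaussian (E := E)).comp_snd (stdGaussian E)) |>.const_mul (A * K)
    refine hb.mono' (hφF.mul (by fun_prop)).aestronglyMeasurable (ae_of_all _ fun p => ?_)
    rw [norm_mul, mul_assoc]
    exact mul_le_mul (hA _ (hPm _)) ((norm_inner_le_norm _ _).trans
      (mul_le_mul (hg.bound_grad _) (norm_neg_sin_smul_add_cos_smul_le θ _ _) (norm_nonneg _) hK0))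
      (norm_nonneg _) hA0
  -- In the rotated variables `u = cos θ x + sin θ y` and `v = -sin θ x + cos θ y`, which are again
  -- independent standard Gaussians, the old variable is `x = cos θ u - sin θ v`.
  have hback : ∀ x y : E, Real.cos θ • (Real.cos θ • x + Real.sin θ • y) -
      Real.sin θ • (-Real.sin θ • x + Real.cos θ • y) = x := fun x y => by
    have : Real.cos θ * Real.cos θ + Real.sin θ * Real.sin θ = 1 := by
      nlinarith [Real.sin_sq_add_cos_sq θ]
    calc _ = (Real.cos θ * Real.cos θ + Real.sin θ * Real.sin θ) • x := by module
      _ = x := by rw [this, one_smul]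
  have hrot := integral_rotation_stdGaussian (E := E) θ
    (F := fun p => φ (mehler θ g (Real.cos θ • p.1 - Real.sin θ • p.2)) * inner ℝ (∇ g p.1) p.2)
    (hφR.mul (by fun_prop))
  simp only [hback] at hrot
  -- Integration by parts in `v` with `u` frozen. The factor `-sin θ` is the inner derivative, and
  -- `cos θ` comes from `∇ P_θ g = cos θ P_θ ∇g`.
  have hstein : ∀ u, ∫ v, φ (mehler θ g (Real.cos θ • u - Real.sin θ • v)) *
      inner ℝ (∇ g u) v ∂stdGaussian E =
      ∫ v, -(Real.sin θ * Real.cos θ) * (φ' (mehler θ g (Real.cos θ • u - Real.sin θ • v)) *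
        inner ℝ (mehler θ (∇ g) (Real.cos θ • u - Real.sin θ • v)) (∇ g u)) ∂stdGaussian E := by
    intro u
    have hvc : Continuous fun v : E => Real.cos θ • u - Real.sin θ • v := by fun_prop
    have h := integral_mul_inner_stdGaussian (E := E) (K := max A (A' * K))
      (F := fun v => φ (mehler θ g (Real.cos θ • u - Real.sin θ • v)))
      (F' := fun v => (-(Real.sin θ * Real.cos θ) *
        φ' (mehler θ g (Real.cos θ • u - Real.sin θ • v))) •
        innerSL ℝ (mehler θ (∇ g) (Real.cos θ • u - Real.sin θ • v)))
      (fun v => by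
        have e1 : HasFDerivAt (fun v : E => Real.cos θ • u - Real.sin θ • v)
            (-(Real.sin θ • ContinuousLinearMap.id ℝ E)) v :=
          ((hasFDerivAt_id v).const_smul (Real.sin θ)).const_sub _
        have e2 := HasFDerivAt.comp (g := mehler θ g) v
          (hasFDerivAt_mehler hg θ (Real.cos θ • u - Real.sin θ • v)) e1
        refine (HasDerivAt.comp_hasFDerivAt v
          (hφ _ (hPm (Real.cos θ • u - Real.sin θ • v))) e2).congr_fderiv ?_
        ext w; simp; ring)
      (((continuous_const.mul (hφP'.comp hvc)).smul ((innerSL ℝ).continuous.comp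
        (hPc'.comp hvc))))
      (fun v => (hA _ (hPm _)).trans (le_max_left _ _))
      (fun v => by
        refine le_trans ?_ (le_max_right _ _)
        rw [norm_smul, innerSL_apply_norm, norm_mul]
        refine mul_le_mul ?_ (norm_mehler_le hg.bound_grad _ _) (norm_nonneg _) hA'0
        have : ‖-(Real.sin θ * Real.cos θ)‖ ≤ 1 := by
          rw [norm_neg, norm_mul]
          exact mul_le_one₀ (Real.abs_sin_le_one θ) (abs_nonneg _) (Real.abs_cos_le_one θ)
        calc _ ≤ 1 * A' := mul_le_mul this (hA' _ (hPm _)) (norm_nonneg _) zero_le_one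
          _ = A' := one_mul _) (∇ g u)
    rw [h]
    refine integral_congr_ae (ae_of_all _ fun v => ?_)
    simp; ring
  have hi2 : Integrable (fun p : E × E =>
      φ' (mehler θ g (Real.cos θ • p.1 - Real.sin θ • p.2)) *
        inner ℝ (mehler θ (∇ g) (Real.cos θ • p.1 - Real.sin θ • p.2)) (∇ g p.1)) Γ :=
    integrable_of_continuous_of_bound (K := A' * (K * K))
      (hφR'.mul (hPR'.inner (by fun_prop))) fun p => by
      rw [norm_mul]
      exact mul_le_mul (hA' _ (hPm _)) ((norm_inner_le_norm _ _).trans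
        (mul_le_mul (norm_mehler_le hg.bound_grad _ _) (hg.bound_grad _) (norm_nonneg _) hK0))
        (norm_nonneg _) hA'0
  have hi3 : Integrable (fun p : E × E => φ' (mehler θ g p.1) *
        inner ℝ (mehler θ (∇ g) p.1) (∇ g (Real.cos θ • p.1 + Real.sin θ • p.2))) Γ :=
    integrable_of_continuous_of_bound (K := A' * (K * K))
      (hφF'.mul (hPF'.inner (by fun_prop))) fun p => by
      rw [norm_mul]
      exact mul_le_mul (hA' _ (hPm _)) ((norm_inner_le_norm _ _).trans
        (mul_le_mul (norm_mehler_le hg.bound_grad _ _) (hg.bound_grad _) (norm_nonneg _) hK0))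
        (norm_nonneg _) hA'0
  -- Rotating back, the only remaining dependence on `y` is in `∇ g`, whose `y`-average is `P_θ ∇g`;
  -- this produces the square.
  have hrot2 := integral_rotation_stdGaussian (E := E) θ
    (F := fun p => φ' (mehler θ g (Real.cos θ • p.1 - Real.sin θ • p.2)) *
        inner ℝ (mehler θ (∇ g) (Real.cos θ • p.1 - Real.sin θ • p.2)) (∇ g p.1))
    (hφR'.mul (hPR'.inner (by fun_prop)))
  simp only [hback] at hrot2
  simp_rw [← integral_const_mul (φ _)]
  rw [← integral_prod _ hi', hrot, integral_prod _ hi]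
  simp_rw [hstein, integral_const_mul]
  rw [← integral_prod _ hi2, ← hrot2, integral_prod _ hi3]
  congr 2
  ext x
  simp only
  rw [integral_const_mul, integral_inner (integrable_mehler hc' hg.bound_grad θ x)]
  rw [← real_inner_self_eq_norm_sq]
  rfl

/-- Comparison of `∫ Φ(g) - Φ(∫ g)` with the energy for the standard Gaussian measure. -/
theorem integral_comp_sub_le_stdGaussian {g : E → ℝ} {K m M : ℝ} (hg : BddC1 g K)
    (hm : ∀ x, g x ∈ Icc m M) {Φ φ φ' : ℝ → ℝ} (hΦ : ∀ u ∈ Icc m M, HasDerivAt Φ (φ u) u)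
    (hφ : ∀ u ∈ Icc m M, HasDerivAt φ (φ' u) u) (hφ' : ContinuousOn φ' (Icc m M))
    {Γ : E → ℝ} {B : ℝ} (hΓ : Continuous Γ) (hB : ∀ x, ‖Γ x‖ ≤ B)
    (h : ∀ θ x, φ' (mehler θ g x) * ‖mehler θ (∇ g) x‖ ^ 2 ≤ mehler θ Γ x) :
    ∫ x, Φ (g x) ∂stdGaussian E - Φ (∫ x, g x ∂stdGaussian E) ≤
      (∫ x, Γ x ∂stdGaussian E) / 2 := by
  have hc := hg.continuous
  have hc' := hg.continuous_grad
  have hK0 := hg.nonneg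
  have hΦc : ContinuousOn Φ (Icc m M) := fun u hu => (hΦ u hu).continuousAt.continuousWithinAt
  have hφc : ContinuousOn φ (Icc m M) := fun u hu => (hφ u hu).continuousAt.continuousWithinAt
  obtain ⟨A0, hA0⟩ := isCompact_Icc.exists_bound_of_continuousOn hΦc
  obtain ⟨A, hA⟩ := isCompact_Icc.exists_bound_of_continuousOn hφc
  obtain ⟨A', hA'⟩ := isCompact_Icc.exists_bound_of_continuousOn hφ'
  have hA_nonneg : 0 ≤ A := (norm_nonneg _).trans (hA _ (hm 0))
  set R := ∫ y : E, ‖y‖ ∂stdGaussian E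
  have hΦP : ∀ θ, Continuous fun x => Φ (mehler θ g x) := fun θ =>
    hΦc.comp_continuous (continuous_mehler hc hg.bound θ) (mehler_mem_Icc hc hm θ)
  have hφP : ∀ θ, Continuous fun x => φ (mehler θ g x) := fun θ =>
    hφc.comp_continuous (continuous_mehler hc hg.bound θ) (mehler_mem_Icc hc hm θ)
  have hφP' : ∀ θ, Continuous fun x => φ' (mehler θ g x) := fun θ =>
    hφ'.comp_continuous (continuous_mehler hc hg.bound θ) (mehler_mem_Icc hc hm θ)
  have hder : ∀ θ, HasDerivAt (fun θ => ∫ x, Φ (mehler θ g x) ∂stdGaussian E)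
      (-(Real.sin θ * Real.cos θ) *
        ∫ x, φ' (mehler θ g x) * ‖mehler θ (∇ g) x‖ ^ 2 ∂stdGaussian E) θ := by
    intro θ
    rw [← integral_deriv_mehler hg hm hφ hφ' θ]
    refine (hasDerivAt_integral_of_dominated_loc_of_deriv_le (μ := stdGaussian E)
      (F := fun θ x => Φ (mehler θ g x))
      (F' := fun θ x => φ (mehler θ g x) *
        ∫ y, inner ℝ (∇ g (Real.cos θ • x + Real.sin θ • y))
        (-Real.sin θ • x + Real.cos θ • y) ∂stdGaussian E)
      (x₀ := θ) (s := univ) (bound := fun x => A * (K * (‖x‖ + R))) univ_mem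
      (Eventually.of_forall fun θ => (hΦP θ).aestronglyMeasurable)
      (integrable_of_continuous_of_bound (hΦP θ) fun x => hA0 _ (mehler_mem_Icc hc hm θ x))
      ((hφP θ).aestronglyMeasurable.mul ?_)
      (ae_of_all _ fun x θ _ => ?_)
      (((integrable_norm_stdGaussian.add (integrable_const _)).const_mul _).const_mul _)
      (ae_of_all _ fun x θ _ => (hΦ _ (mehler_mem_Icc hc hm θ x)).comp θ
        (hasDerivAt_mehler hg θ x))).2
    · refine StronglyMeasurable.aestronglyMeasurable ?_
      refine StronglyMeasurable.integral_prod_right (f := fun x y : E =>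
        inner ℝ (∇ g (Real.cos θ • x + Real.sin θ • y)) (-Real.sin θ • x + Real.cos θ • y)) ?_
      exact Continuous.stronglyMeasurable (by fun_prop)
    · rw [norm_mul]
      refine mul_le_mul (hA _ (mehler_mem_Icc hc hm θ x)) ?_ (norm_nonneg _) hA_nonneg
      calc _ ≤ ∫ y : E, K * (‖x‖ + ‖y‖) ∂stdGaussian E := by
            refine norm_integral_le_of_norm_le
              (((integrable_const _).add integrable_norm_stdGaussian).const_mul _)
              (ae_of_all _ fun y => (norm_inner_le_norm _ _).trans (mul_le_mul (hg.bound_grad _)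
                (norm_neg_sin_smul_add_cos_smul_le θ x y) (norm_nonneg _) hK0))
        _ = _ := by
          rw [integral_const_mul, integral_add (integrable_const _) integrable_norm_stdGaussian]
          simp [R]
  set D := ∫ x, Γ x ∂stdGaussian E
  have hdis : ∀ θ, ∫ x, φ' (mehler θ g x) * ‖mehler θ (∇ g) x‖ ^ 2 ∂stdGaussian E ≤ D := by
    intro θ
    rw [show D = _ from (integral_mehler hΓ hB θ).symm]
    have hPc' := continuous_mehler hc' hg.bound_grad θ
    refine integral_mono (integrable_of_continuous_of_bound (K := A' * K ^ 2)
      ((hφP' θ).mul (hPc'.norm.pow 2))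
      fun x => ?_) (integrable_of_continuous_of_bound (continuous_mehler hΓ hB θ)
      (norm_mehler_le hB θ)) (h θ)
    rw [norm_mul, norm_pow, norm_norm]
    have h1 := hA' _ (mehler_mem_Icc hc hm θ x)
    exact mul_le_mul h1 (pow_le_pow_left₀ (norm_nonneg _)
      (norm_mehler_le hg.bound_grad _ _) 2) (by positivity) ((norm_nonneg _).trans h1)
  -- `sin² θ / 2` is the primitive of `sin θ cos θ`; its total increase `1/2` on `[0, π/2]` is the
  -- constant in the conclusion.
  have hmono : MonotoneOn (fun θ => ∫ x, Φ (mehler θ g x) ∂stdGaussian E +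
      Real.sin θ ^ 2 / 2 * D) (Icc 0 (Real.pi / 2)) := by
    have hder2 : ∀ θ, HasDerivAt (fun θ => ∫ x, Φ (mehler θ g x) ∂stdGaussian E +
      Real.sin θ ^ 2 / 2 * D) (-(Real.sin θ * Real.cos θ) *
        (∫ x, φ' (mehler θ g x) * ‖mehler θ (∇ g) x‖ ^ 2 ∂stdGaussian E) +
        (Real.sin θ * Real.cos θ) * D) θ := fun θ => by
      refine (hder θ).add ?_
      have := ((Real.hasDerivAt_sin θ).pow 2).div_const 2 |>.mul_const D
      refine this.congr_deriv ?_
      simp only [Nat.cast_ofNat, Nat.add_one_sub_one, pow_one]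
      ring
    refine monotoneOn_of_deriv_nonneg (convex_Icc _ _)
      (fun θ _ => (hder2 θ).continuousAt.continuousWithinAt)
      (fun θ _ => (hder2 θ).differentiableAt.differentiableWithinAt) fun θ hθ => ?_
    rw [(hder2 θ).deriv]
    rw [interior_Icc] at hθ
    have h1 : 0 ≤ Real.sin θ :=
      Real.sin_nonneg_of_nonneg_of_le_pi hθ.1.le (by linarith [hθ.2, Real.pi_pos])
    have h2 : 0 ≤ Real.cos θ := Real.cos_nonneg_of_neg_pi_div_two_le_of_le
      (by linarith [hθ.1, Real.pi_pos]) hθ.2.le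
    nlinarith [mul_le_mul_of_nonneg_left (hdis θ) (mul_nonneg h1 h2)]
  -- `P_0 g = g`, while `P_{π/2} g` is the constant `∫ g`.
  have hfin := hmono (left_mem_Icc.2 (by positivity)) (right_mem_Icc.2 (by positivity))
    (by positivity)
  simp [mehler] at hfin
  linarith

end Interpolation

/-! ### Poincaré and log-Sobolev inequalities for the standard Gaussian. -/

section GaussianInequalities

/-- Jensen for the jointly convex function `(v, w) ↦ ‖v‖²/w`, proved by integrating its tangent at
the mean `(b, W)`. It supplies the commutation bound `φ'(P_θ g)‖P_θ ∇g‖² ≤ P_θ Γ` for both choices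
of `Φ`. -/
lemma sq_norm_integral_div_le {α V : Type*} [MeasurableSpace α] [NormedAddCommGroup V]
    [InnerProductSpace ℝ V] [CompleteSpace V] {ν : Measure α} {v : α → V} {w : α → ℝ}
    (hv : Integrable v ν) (hw : Integrable w ν) (hvw : Integrable (fun x => ‖v x‖ ^ 2 / w x) ν)
    (hpos : ∀ x, 0 < w x) (hpos' : 0 < ∫ x, w x ∂ν) :
    ‖∫ x, v x ∂ν‖ ^ 2 / ∫ x, w x ∂ν ≤ ∫ x, ‖v x‖ ^ 2 / w x ∂ν := by
  set b := ∫ x, v x ∂ν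
  set W := ∫ x, w x ∂ν
  have h1 : ∀ x, 2 / W * inner ℝ b (v x) - ‖b‖ ^ 2 / W ^ 2 * w x ≤ ‖v x‖ ^ 2 / w x := by
    intro x
    have hx := hpos x
    have hn : 0 ≤ ‖v x - (w x / W) • b‖ ^ 2 := sq_nonneg _
    rw [norm_sub_sq_real, norm_smul, inner_smul_right, real_inner_comm, mul_pow,
      Real.norm_eq_abs, sq_abs] at hn
    rw [le_div_iff₀ hx]
    calc _ = 2 * (w x / W * inner ℝ b (v x)) - (w x / W) ^ 2 * ‖b‖ ^ 2 := by
          field_simp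
      _ ≤ _ := by linarith
  have h2 := integral_mono (((hv.const_inner b).const_mul (2 / W)).sub
    (hw.const_mul (‖b‖ ^ 2 / W ^ 2))) hvw h1
  refine le_trans (le_of_eq ?_) h2
  simp only [Pi.sub_apply]
  rw [integral_sub ((hv.const_inner b).const_mul (2 / W)) (hw.const_mul (‖b‖ ^ 2 / W ^ 2)),
    integral_const_mul, integral_const_mul, integral_inner hv, real_inner_self_eq_norm_sq]
  change ‖b‖ ^ 2 / W = 2 / W * ‖b‖ ^ 2 - ‖b‖ ^ 2 / W ^ 2 * W
  field_simp
  ring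

variable {E : Type*} [NormedAddCommGroup E] [InnerProductSpace ℝ E] [FiniteDimensional ℝ E]
  [MeasurableSpace E] [BorelSpace E]

/-- The Poincaré inequality for the standard Gaussian measure. -/
theorem poincare_stdGaussian {g : E → ℝ} {K : ℝ} (hg : BddC1 g K) :
    ∫ x, g x ^ 2 ∂stdGaussian E - (∫ x, g x ∂stdGaussian E) ^ 2 ≤
      ∫ x, ‖∇ g x‖ ^ 2 ∂stdGaussian E := by
  have hc := hg.continuous
  have hc' := hg.continuous_grad
  have hsq : ∀ x, ‖‖∇ g x‖ ^ 2‖ ≤ K ^ 2 := fun x => by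
    rw [norm_pow, norm_norm]
    exact pow_le_pow_left₀ (norm_nonneg _) (hg.bound_grad x) 2
  have hsq2 : ∀ x, ‖2 * ‖∇ g x‖ ^ 2‖ ≤ 2 * K ^ 2 := fun x => by
    rw [norm_mul, Real.norm_ofNat]
    linarith [hsq x]
  have h := integral_comp_sub_le_stdGaussian (m := -K) (M := K) hg (fun x => abs_le.1 (hg.bound x))
    (Φ := fun u => u ^ 2) (φ := fun u => 2 * u) (φ' := fun _ => 2)
    (fun u _ => by simpa using hasDerivAt_pow 2 u)
    (fun u _ => by simpa using (hasDerivAt_id u).const_mul (2 : ℝ)) continuousOn_const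
    (Γ := fun x => 2 * ‖∇ g x‖ ^ 2) (B := 2 * K ^ 2) (by fun_prop) hsq2
    (fun θ x => by
      have h1 := sq_norm_integral_div_le (w := fun _ => 1)
        (integrable_mehler hc' hg.bound_grad θ x) (integrable_const _)
        (by simpa using (integrable_mehler (g := fun x => ‖∇ g x‖ ^ 2) (by fun_prop) hsq θ x))
        (fun _ => zero_lt_one) (by simp)
      simp only [integral_const, probReal_univ, smul_eq_mul, mul_one, div_one] at h1
      simp only [mehler, integral_const_mul]
      linarith)
  rw [integral_const_mul] at h
  linarith

/-- The logarithmic Sobolev inequality for the standard Gaussian measure, for functions bounded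
away from zero. -/
theorem log_sobolev_stdGaussian {g : E → ℝ} {K m : ℝ} (hg : BddC1 g K) (hm : 0 < m)
    (hgm : ∀ x, m ≤ g x) :
    ∫ x, g x * Real.log (g x) ∂stdGaussian E -
        (∫ x, g x ∂stdGaussian E) * Real.log (∫ x, g x ∂stdGaussian E) ≤
      (∫ x, ‖∇ g x‖ ^ 2 / g x ∂stdGaussian E) / 2 := by
  have hc := hg.continuous
  have hc' := hg.continuous_grad
  have hpos : ∀ x, 0 < g x := fun x => hm.trans_le (hgm x)
  have hgI : ∀ x, g x ∈ Icc m K := fun x => ⟨hgm x, (le_abs_self _).trans (hg.bound x)⟩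
  have hΓc : Continuous fun x => ‖∇ g x‖ ^ 2 / g x :=
    (hc'.norm.pow 2).div hc fun x => (hpos x).ne'
  have hΓb : ∀ x, ‖‖∇ g x‖ ^ 2 / g x‖ ≤ K ^ 2 / m := fun x => by
    rw [norm_div, norm_pow, norm_norm, Real.norm_of_nonneg (hpos x).le]
    exact div_le_div₀ (sq_nonneg _) (pow_le_pow_left₀ (norm_nonneg _) (hg.bound_grad x) 2) hm
      (hgm x)
  refine integral_comp_sub_le_stdGaussian (m := m) (M := K) hg hgI
    (Φ := fun u => u * Real.log u) (φ := fun u => Real.log u + 1) (φ' := fun u => u⁻¹)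
    (fun u hu => ?_)
    (fun u hu => (Real.hasDerivAt_log (hm.trans_le hu.1).ne').add_const 1)
    (continuousOn_inv₀.mono fun u hu => (hm.trans_le hu.1).ne')
    (Γ := fun x => ‖∇ g x‖ ^ 2 / g x) hΓc hΓb (fun θ x => ?_)
  · have hu0 : u ≠ 0 := (hm.trans_le hu.1).ne'
    refine ((hasDerivAt_id u).mul (Real.hasDerivAt_log hu0)).congr_deriv ?_
    simp [hu0]
  · have h1 := sq_norm_integral_div_le (integrable_mehler hc' hg.bound_grad θ x)
      (integrable_mehler hc hg.bound θ x) (integrable_mehler hΓc hΓb θ x) (fun _ => hpos _)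
      (hm.trans_le (mehler_mem_Icc hc hgI θ x).1)
    rw [mul_comm, ← div_eq_mul_inv]
    exact h1

end GaussianInequalities

/-! ### Translates of the Gaussian: density, χ²-divergence, Harnack-type bound. -/

section CameronMartin

lemma gaussianReal_eq_withDensity (a : ℝ) :
    gaussianReal a 1 = (gaussianReal 0 1).withDensity
      fun x => ENNReal.ofReal (Real.exp (a * x - a ^ 2 / 2)) := by
  rw [gaussianReal_of_var_ne_zero _ one_ne_zero, gaussianReal_of_var_ne_zero _ one_ne_zero,
    ← withDensity_mul _ (by fun_prop) (by fun_prop)]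
  congr 1
  ext x
  simp only [gaussianPDF, Pi.mul_apply, gaussianPDFReal]
  rw [← ENNReal.ofReal_mul (by positivity), mul_assoc _ (Real.exp _) (Real.exp _), ← Real.exp_add]
  congr 3
  push_cast
  ring

lemma pi_gaussianReal_map_add {ι : Type*} [Fintype ι] (a : ι → ℝ) :
    (Measure.pi fun _ : ι => gaussianReal 0 1).map (fun x i => x i + a i) =
      (Measure.pi fun _ : ι => gaussianReal 0 1).withDensity
        fun x => ∏ i, ENNReal.ofReal (Real.exp (a i * x i - a i ^ 2 / 2)) := by
  have : ∀ i, SigmaFinite ((gaussianReal 0 1).map fun x => x + a i) := fun i => by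
    rw [gaussianReal_map_add_const]; infer_instance
  rw [Measure.pi_map_pi (μ := fun _ : ι => gaussianReal 0 1) (f := fun i x => x + a i)
    (fun i => by fun_prop)]
  refine Measure.pi_eq fun s hs => ?_
  set f : ι → ℝ → ℝ≥0∞ := fun i =>
    (s i).indicator fun x => ENNReal.ofReal (Real.exp (a i * x - a i ^ 2 / 2))
  have hf : ∀ i, Measurable (f i) := fun i => Measurable.indicator (by fun_prop) (hs i)
  rw [withDensity_apply _ (.univ_pi hs), ← lintegral_indicator (.univ_pi hs)]
  have h1 : ((pi univ s).indicator fun x : ι → ℝ =>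
      ∏ i, ENNReal.ofReal (Real.exp (a i * x i - a i ^ 2 / 2))) = fun x => ∏ i, f i (x i) := by
    ext x
    by_cases hx : x ∈ pi univ s
    · rw [indicator_of_mem hx]
      refine Finset.prod_congr rfl fun i _ => ?_
      simp only [f]
      rw [indicator_of_mem (hx i (mem_univ i))]
    · rw [indicator_of_notMem hx]
      simp only [Set.mem_pi, mem_univ, true_implies, not_forall] at hx
      obtain ⟨i, hi⟩ := hx
      exact (Finset.prod_eq_zero (Finset.mem_univ i) (indicator_of_notMem hi _)).symm
  have h3 := lintegral_prod_eq_prod_lintegral_of_indepFun Finset.univ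
    (fun i (x : ι → ℝ) => f i (x i))
    (iIndepFun_pi (μ := fun _ : ι => gaussianReal 0 1) fun i => (hf i).aemeasurable)
    (fun i => (hf i).comp (measurable_pi_apply i))
  rw [h1]
  refine h3.trans ?_
  refine Finset.prod_congr rfl fun i _ => ?_
  have h2 := (measurePreserving_eval (fun _ : ι => gaussianReal 0 1) i).lintegral_comp (hf i)
  simp only [Function.eval] at h2
  rw [h2, gaussianReal_map_add_const, zero_add, gaussianReal_eq_withDensity (a i),
    withDensity_apply _ (hs i), ← lintegral_indicator (hs i)]

variable {d : ℕ}

/-- The density of the translate by `a` of the standard Gaussian measure. -/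
noncomputable def shiftDensity (a z : Space d) : ℝ := Real.exp (inner ℝ a z - ‖a‖ ^ 2 / 2)

@[fun_prop]
lemma continuous_shiftDensity (a : Space d) : Continuous (shiftDensity a) := by
  unfold shiftDensity; fun_prop

lemma shiftDensity_pos (a z : Space d) : 0 < shiftDensity a z := Real.exp_pos _

lemma shiftDensity_neg (a z : Space d) :
    shiftDensity (-a) z = (shiftDensity a z)⁻¹ * Real.exp (-‖a‖ ^ 2) := by
  rw [shiftDensity, shiftDensity, ← Real.exp_neg, ← Real.exp_add, inner_neg_left, norm_neg]
  congr 1; ring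

/-- The Cameron-Martin formula. -/
lemma stdGaussian_map_add (a : Space d) :
    (stdGaussian (Space d)).map (fun z => z + a) =
      (stdGaussian (Space d)).withDensity fun z => ENNReal.ofReal (shiftDensity a z) := by
  have hm : Measurable (WithLp.toLp 2 : (Fin d → ℝ) → Space d) := by fun_prop
  ext s hs
  rw [← map_pi_eq_stdGaussian, Measure.map_map (by fun_prop) hm, withDensity_apply _ hs,
    setLIntegral_map hs (by fun_prop) hm, Measure.map_apply (by fun_prop) hs]
  have h1 : (fun z => z + a) ∘ (WithLp.toLp 2 : (Fin d → ℝ) → Space d) =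
      WithLp.toLp 2 ∘ fun x i => x i + a i := by
    ext x i; simp
  rw [h1, preimage_comp, ← Measure.map_apply (by fun_prop) (hm hs), pi_gaussianReal_map_add,
    withDensity_apply _ (hm hs)]
  refine setLIntegral_congr_fun (hm hs) fun x _ => ?_
  simp only
  rw [← ENNReal.ofReal_prod_of_nonneg fun i _ => (Real.exp_pos _).le, ← Real.exp_sum]
  congr 2
  rw [Finset.sum_sub_distrib, ← Finset.sum_div, EuclideanSpace.real_norm_sq_eq]
  simp [PiLp.inner_apply, mul_comm]

lemma integral_add_stdGaussian (H : Space d → ℝ) (hH : Continuous H) (a : Space d) :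
    ∫ z, H (z + a) ∂stdGaussian (Space d) =
      ∫ z, H z * shiftDensity a z ∂stdGaussian (Space d) := by
  rw [← integral_map (φ := fun z => z + a) (by fun_prop) hH.aestronglyMeasurable,
    stdGaussian_map_add, integral_withDensity_eq_integral_toReal_smul (by fun_prop)
      (ae_of_all _ fun _ => ENNReal.ofReal_lt_top)]
  refine integral_congr_ae (ae_of_all _ fun z => ?_)
  simp only [ENNReal.toReal_ofReal (shiftDensity_pos a z).le, smul_eq_mul, mul_comm]

lemma integral_shiftDensity (a : Space d) :
    ∫ z, shiftDensity a z ∂stdGaussian (Space d) = 1 := by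
  have := integral_add_stdGaussian (fun _ => 1) continuous_const a
  simpa using this.symm

lemma integrable_shiftDensity (a : Space d) :
    Integrable (shiftDensity a) (stdGaussian (Space d)) :=
  Integrable.of_integral_ne_zero (by rw [integral_shiftDensity]; exact one_ne_zero)

lemma integrable_mul_shiftDensity {H : Space d → ℝ} {K : ℝ} (hH : Continuous H)
    (hK : ∀ z, |H z| ≤ K) (a : Space d) :
    Integrable (fun z => H z * shiftDensity a z) (stdGaussian (Space d)) :=
  (integrable_shiftDensity a).bdd_mul hH.aestronglyMeasurable (ae_of_all _ hK)

/-- Squaring doubles the shift, so the second moment of the density is `exp(‖a‖²)` without a new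
Gaussian integral. -/
lemma sq_shiftDensity (a z : Space d) :
    shiftDensity a z ^ 2 = Real.exp (‖a‖ ^ 2) * shiftDensity ((2 : ℝ) • a) z := by
  rw [shiftDensity, shiftDensity, ← Real.exp_nat_mul, ← Real.exp_add, inner_smul_left, norm_smul]
  congr 1
  simp
  ring

/-- Comparison of the means of a function under two translates, via the chi-squared divergence. -/
lemma sq_integral_add_sub_le {H : Space d → ℝ} {K : ℝ} (hH : Continuous H) (hK : ∀ z, |H z| ≤ K)
    (a : Space d) :
    (∫ z, H (z + a) ∂stdGaussian (Space d) - ∫ z, H z ∂stdGaussian (Space d)) ^ 2 ≤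
      (∫ z, H z ^ 2 ∂stdGaussian (Space d) - (∫ z, H z ∂stdGaussian (Space d)) ^ 2) *
        (Real.exp (‖a‖ ^ 2) - 1) := by
  set G := stdGaussian (Space d)
  set u := ∫ z, H z ∂G
  set u' := ∫ z, H (z + a) ∂G
  set S := ∫ z, H z ^ 2 ∂G
  have hu' : u' = ∫ z, H z * shiftDensity a z ∂G := integral_add_stdGaussian H hH a
  have iH : Integrable H G := integrable_of_continuous_of_bound hH hK
  have iH2 : Integrable (fun z => H z ^ 2) G :=
    integrable_of_continuous_of_bound (K := K ^ 2) (by fun_prop) fun z => by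
      rw [norm_pow]; exact pow_le_pow_left₀ (abs_nonneg _) (hK z) 2
  have iHs := integrable_mul_shiftDensity hH hK a
  have is := integrable_shiftDensity a
  have is2 : Integrable (fun z => shiftDensity a z ^ 2) G := by
    simp_rw [sq_shiftDensity]
    exact (integrable_shiftDensity _).const_mul _
  have e2 : ∫ z, shiftDensity a z ^ 2 ∂G = Real.exp (‖a‖ ^ 2) := by
    simp_rw [sq_shiftDensity]
    rw [integral_const_mul, integral_shiftDensity, mul_one]
  -- Cauchy–Schwarz for `u' - u = ∫ (H - u)(ρ_a - 1)`, with `ρ_a` the shift density, in discriminant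
  -- form.
  have key : ∀ r : ℝ, 0 ≤ (Real.exp (‖a‖ ^ 2) - 1) * (r * r) + (-2 * (u' - u)) * r +
      (S - u ^ 2) := by
    intro r
    have h0 : 0 ≤ ∫ z, ((H z - u) - r * (shiftDensity a z - 1)) ^ 2 ∂G :=
      integral_nonneg fun z => sq_nonneg _
    have h1 : ∀ z, ((H z - u) - r * (shiftDensity a z - 1)) ^ 2 =
        H z ^ 2 + (-2 * u + 2 * r) * H z + (-2 * r) * (H z * shiftDensity a z) +
        (r ^ 2) * shiftDensity a z ^ 2 + (2 * u * r - 2 * r ^ 2) * shiftDensity a z +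
        (u ^ 2 + r ^ 2 - 2 * u * r) := fun z => by ring
    simp_rw [h1] at h0
    rw [integral_add, integral_add, integral_add, integral_add, integral_add, integral_const_mul,
      integral_const_mul, integral_const_mul, integral_const_mul, e2, integral_shiftDensity,
      ← hu', integral_const] at h0
    · simp only [probReal_univ, smul_eq_mul] at h0
      change 0 ≤ S + (-2 * u + 2 * r) * u + _ + _ + _ + _ at h0
      nlinarith
    all_goals first | exact integrable_const _ | skip
    all_goals fun_prop
  have := discrim_le_zero key
  rw [discrim] at this
  nlinarith

/-- A Harnack-type comparison of `u = ∫ H` with `u' = ∫ H(· + a)`. -/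
lemma mul_log_div_le {H : Space d → ℝ} {K m : ℝ} (hH : Continuous H) (hm : 0 < m)
    (hHm : ∀ z, m ≤ H z) (hK : ∀ z, H z ≤ K) (a : Space d) :
    (∫ z, H z ∂stdGaussian (Space d)) * (Real.log (∫ z, H z ∂stdGaussian (Space d)) -
        Real.log (∫ z, H (z + a) ∂stdGaussian (Space d))) ≤
      ent (stdGaussian (Space d)) H + (∫ z, H z ∂stdGaussian (Space d)) * ‖a‖ ^ 2 := by
  set G := stdGaussian (Space d)
  have hpos : ∀ z, 0 < H z := fun z => hm.trans_le (hHm z)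
  have hb : ∀ z, |H z| ≤ K := fun z => by rw [abs_of_pos (hpos z)]; exact hK z
  have iH : Integrable H G := integrable_of_continuous_of_bound hH hb
  have hHlc : Continuous fun z => H z * Real.log (H z) :=
    hH.mul (hH.log fun z => (hpos z).ne')
  obtain ⟨A, hA⟩ := isCompact_Icc.exists_bound_of_continuousOn
    (s := Icc m K) (f := fun u => u * Real.log u) Real.continuous_mul_log.continuousOn
  have iHl : Integrable (fun z => H z * Real.log (H z)) G :=
    integrable_of_continuous_of_bound hHlc fun z => hA (H z) ⟨hHm z, hK z⟩
  have hu : 0 < ∫ z, H z ∂G := hm.trans_le (by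
    simpa using integral_mono (integrable_const (μ := G) m) iH hHm)
  have hu' : 0 < ∫ z, H (z + a) ∂G := hm.trans_le (by
    simpa using integral_mono (integrable_const (μ := G) m)
      (integrable_of_continuous_of_bound (by fun_prop) fun z => hb (z + a)) fun z => hHm (z + a))
  have e1 := integral_add_stdGaussian H hH a
  have iHs := integrable_mul_shiftDensity hH hb a
  set u := ∫ z, H z ∂G
  set u' := ∫ z, H (z + a) ∂G
  -- Two convexity bounds under the law with density `H/u`: Jensen for the log of the shift density
  -- (`l2`), and entropy duality against the opposite shift (`l1`). Each costs `‖a‖²/2`. Pointwise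
  -- both are `log x ≥ 1 - 1/x`, and the left side integrates to `2u - u - u = 0`.
  have h1 : ∀ z, 2 * H z - u * shiftDensity (-a) z - u / u' * (H z * shiftDensity a z) ≤
      H z * Real.log (H z) + (Real.log u' - 2 * Real.log u + ‖a‖ ^ 2) * H z := by
    intro z
    have hz := hpos z
    have hs := shiftDensity_pos a z
    have hneg := shiftDensity_neg a z
    set r := shiftDensity a z
    have l1 := Real.one_sub_inv_le_log_of_pos
      (x := H z * Real.exp (‖a‖ ^ 2) * r / u) (by positivity)
    have l2 := Real.one_sub_inv_le_log_of_pos (x := u' / (u * r)) (by positivity)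
    rw [Real.log_div (by positivity) (by positivity), Real.log_mul (by positivity) hs.ne',
      Real.log_mul hz.ne' (by positivity), Real.log_exp] at l1
    rw [Real.log_div hu'.ne' (by positivity), Real.log_mul hu.ne' hs.ne'] at l2
    have l3 : H z * ((1 - (H z * Real.exp (‖a‖ ^ 2) * r / u)⁻¹) + (1 - (u' / (u * r))⁻¹)) =
        2 * H z - u * shiftDensity (-a) z - u / u' * (H z * r) := by
      rw [hneg, Real.exp_neg]
      field_simp
      ring
    rw [← l3]
    nlinarith [mul_le_mul_of_nonneg_left (add_le_add l1 l2) hz.le]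
  have h2 := integral_mono ((((iH.const_mul 2).sub
    ((integrable_shiftDensity (-a)).const_mul u))).sub (iHs.const_mul (u / u')))
    (iHl.add (iH.const_mul _)) h1
  simp only [Pi.sub_apply, Pi.add_apply] at h2
  rw [integral_sub, integral_sub, integral_add iHl (iH.const_mul _), integral_const_mul,
    integral_const_mul, integral_const_mul, integral_const_mul, integral_shiftDensity, ← e1] at h2
  · change 2 * u - u * 1 - u / u' * u' ≤ _ at h2
    rw [div_mul_cancel₀ _ hu'.ne'] at h2
    rw [ent]
    change _ ≤ _ - u * Real.log u + _
    change _ ≤ _ + _ * u at h2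
    nlinarith
  · exact iH.const_mul 2
  · exact (integrable_shiftDensity (-a)).const_mul u
  · exact (iH.const_mul 2).sub ((integrable_shiftDensity (-a)).const_mul u)
  · exact iHs.const_mul (u / u')

end CameronMartin

/-! ### Gaussian convolutions as mixtures; the Poincaré inequality. -/

section Mixture

variable {d : ℕ}

lemma integral_sub_const_sq {α : Type*} [MeasurableSpace α] {ν : Measure α}
    [IsProbabilityMeasure ν] {f : α → ℝ} (hf : Integrable f ν)
    (hf2 : Integrable (fun x => f x ^ 2) ν) (c : ℝ) :
    ∫ x, (f x - c) ^ 2 ∂ν = ∫ x, f x ^ 2 ∂ν - 2 * c * ∫ x, f x ∂ν + c ^ 2 := by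
  have h : ∀ x, (f x - c) ^ 2 = f x ^ 2 - 2 * c * f x + c ^ 2 := fun x => by ring
  simp_rw [h]
  rw [integral_add (f := fun x => f x ^ 2 - 2 * c * f x) (hf2.sub (hf.const_mul _))
    (integrable_const _), integral_sub hf2 (hf.const_mul _), integral_const_mul, integral_const]
  simp

lemma sq_integral_le {α : Type*} [MeasurableSpace α] {ν : Measure α}
    [IsProbabilityMeasure ν] {f : α → ℝ} (hf : Integrable f ν)
    (hf2 : Integrable (fun x => f x ^ 2) ν) : (∫ x, f x ∂ν) ^ 2 ≤ ∫ x, f x ^ 2 ∂ν := by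
  have h : 0 ≤ ∫ x, (f x - ∫ y, f y ∂ν) ^ 2 ∂ν := integral_nonneg fun _ => sq_nonneg _
  rw [integral_sub_const_sq hf hf2] at h
  linarith

lemma gaussian_eq_map (t : ℝ) (ht : 0 ≤ t) :
    gaussian d t = (stdGaussian (Space d)).map fun z => √t • z := by
  have : IsProbabilityMeasure ((stdGaussian (Space d)).map fun z => √t • z) :=
    Measure.isProbabilityMeasure_map (by fun_prop)
  have : IsProbabilityMeasure (gaussian d t) := by unfold gaussian; infer_instance
  apply Measure.ext_of_charFun
  ext x
  rw [gaussian, charFun_multivariateGaussian (Matrix.PosSemidef.one.smul ht), charFun_map_smul,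
    charFun_stdGaussian, ← Complex.ofReal_pow, norm_smul, mul_pow, Real.norm_eq_abs, sq_abs,
    Real.sq_sqrt ht, EuclideanSpace.real_norm_sq_eq]
  congr 1
  have h : x.ofLp ⬝ᵥ ((t • (1 : Matrix (Fin d) (Fin d) ℝ)).mulVec x.ofLp) =
      t * ∑ i, x.ofLp i ^ 2 := by
    rw [Matrix.smul_mulVec, Matrix.one_mulVec, dotProduct_smul, smul_eq_mul]
    simp only [dotProduct, sq]
  rw [h]
  simp [neg_div]

/-- The average of `F` under the Gaussian measure centred at `x` with covariance `s² I`. -/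
noncomputable def avg (s : ℝ) (F : Space d → ℝ) (x : Space d) : ℝ :=
  ∫ z, F (x + s • z) ∂stdGaussian (Space d)

lemma integrable_avg {F : Space d → ℝ} {K : ℝ} (hF : Continuous F) (hK : ∀ x, |F x| ≤ K)
    (s : ℝ) (x : Space d) : Integrable (fun z => F (x + s • z)) (stdGaussian (Space d)) :=
  integrable_of_continuous_of_bound (by fun_prop) fun _ => hK _

lemma abs_avg_le {F : Space d → ℝ} {K : ℝ} (hK : ∀ x, |F x| ≤ K) (s : ℝ) (x : Space d) :
    |avg s F x| ≤ K := by
  rw [avg]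
  simpa using norm_integral_le_of_norm_le_const (μ := stdGaussian (Space d))
    (ae_of_all _ fun z => show ‖F (x + s • z)‖ ≤ K from hK _)

lemma continuous_avg {F : Space d → ℝ} {K : ℝ} (hF : Continuous F) (hK : ∀ x, |F x| ≤ K)
    (s : ℝ) : Continuous (avg s F) :=
  continuous_of_dominated (bound := fun _ => K)
    (fun x => (Continuous.aestronglyMeasurable (by fun_prop)))
    (fun x => ae_of_all _ fun y => hK _) (integrable_const _) (ae_of_all _ fun y => by fun_prop)

lemma avg_mono {F F' : Space d → ℝ} {K K' : ℝ} (hF : Continuous F) (hK : ∀ x, |F x| ≤ K)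
    (hF' : Continuous F') (hK' : ∀ x, |F' x| ≤ K') (h : ∀ x, F x ≤ F' x) (s : ℝ) (x : Space d) :
    avg s F x ≤ avg s F' x :=
  integral_mono (integrable_avg hF hK s x) (integrable_avg hF' hK' s x) fun _ => h _

lemma integral_conv_gaussian (μ : Measure (Space d)) [IsProbabilityMeasure μ] {t : ℝ} (ht : 0 ≤ t)
    {F : Space d → ℝ} {K : ℝ} (hF : Continuous F) (hK : ∀ x, |F x| ≤ K) :
    ∫ x, F x ∂(μ.conv (gaussian d t)) = ∫ x, avg (√t) F x ∂μ := by
  have : IsProbabilityMeasure (gaussian d t) := by unfold gaussian; infer_instance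
  rw [integral_conv (integrable_of_continuous_of_bound hF hK)]
  refine integral_congr_ae (ae_of_all _ fun x => ?_)
  simp only [avg]
  rw [gaussian_eq_map t ht, integral_map (by fun_prop) (Continuous.aestronglyMeasurable
    (by fun_prop))]

/-- In the coordinates of the component at `x'`, the one at `x` is the standard Gaussian shifted by
`(x - x')/s`; this makes the Cameron–Martin comparisons applicable. -/
lemma avg_eq_integral_add {s : ℝ} (hs : s ≠ 0) (F : Space d → ℝ) (x x' : Space d) :
    avg s F x = ∫ z, F (x' + s • (z + s⁻¹ • (x - x'))) ∂stdGaussian (Space d) := by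
  refine integral_congr_ae (ae_of_all _ fun z => ?_)
  simp only
  congr 1
  rw [smul_add, smul_inv_smul₀ hs]
  abel

lemma norm_inv_sqrt_smul_sq {t : ℝ} (ht : 0 ≤ t) (x : Space d) :
    ‖(√t)⁻¹ • x‖ ^ 2 = ‖x‖ ^ 2 / t := by
  rw [norm_smul, mul_pow, norm_inv, inv_pow, Real.norm_eq_abs, sq_abs, Real.sq_sqrt ht]
  ring

lemma BddC1.gradient_comp_affine {f : Space d → ℝ} {K : ℝ} (hf : BddC1 f K) (s : ℝ)
    (x z : Space d) : HasFDerivAt (fun z => f (x + s • z)) (innerSL ℝ (s • ∇ f (x + s • z))) z := by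
  have e1 : HasFDerivAt (fun z : Space d => x + s • z)
      (s • ContinuousLinearMap.id ℝ (Space d)) z :=
    ((hasFDerivAt_id z).const_smul s).const_add _
  refine ((hf.hasFDerivAt _).comp z e1).congr_fderiv ?_
  ext v; simp

lemma gradient_eq_of_hasFDerivAt {f : Space d → ℝ} {v x : Space d}
    (h : HasFDerivAt f (innerSL ℝ v) x) : ∇ f x = v := by
  refine HasGradientAt.gradient ?_
  rw [hasGradientAt_iff_hasFDerivAt]
  exact h

lemma BddC1.of_hasFDerivAt {f : Space d → ℝ} {f' : Space d → Space d} {K : ℝ}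
    (h : ∀ x, HasFDerivAt f (innerSL ℝ (f' x)) x) (hc : Continuous f') (hK : ∀ x, |f x| ≤ K)
    (hK' : ∀ x, ‖f' x‖ ≤ K) : BddC1 f K ∧ ∇ f = f' := by
  have e : ∇ f = f' := funext fun x => gradient_eq_of_hasFDerivAt (h x)
  exact ⟨⟨by rw [e]; exact h, by rw [e]; exact hc, hK, by rw [e]; exact hK'⟩, e⟩

lemma BddC1.comp_affine {f : Space d → ℝ} {K : ℝ} (hf : BddC1 f K) (s : ℝ) (x : Space d) :
    BddC1 (fun z => f (x + s • z)) (K * (1 + |s|)) ∧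
      ∇ (fun z => f (x + s • z)) = fun z => s • ∇ f (x + s • z) := by
  have hc := hf.continuous_grad
  refine BddC1.of_hasFDerivAt (fun z => hf.gradient_comp_affine s x z) (by fun_prop)
    (fun z => (hf.bound _).trans ?_) (fun z => ?_)
  · exact le_mul_of_one_le_right hf.nonneg (by linarith [abs_nonneg s])
  · rw [norm_smul, Real.norm_eq_abs]
    nlinarith [mul_le_mul_of_nonneg_left (hf.bound_grad (x + s • z)) (abs_nonneg s), hf.nonneg]

lemma BddC1.abs_sq_le {f : Space d → ℝ} {K : ℝ} (hf : BddC1 f K) (x : Space d) :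
    |f x ^ 2| ≤ K ^ 2 := by
  rw [abs_pow]; exact pow_le_pow_left₀ (abs_nonneg _) (hf.bound x) 2

lemma BddC1.abs_sq_grad_le {f : Space d → ℝ} {K : ℝ} (hf : BddC1 f K) (x : Space d) :
    |‖∇ f x‖ ^ 2| ≤ K ^ 2 := by
  rw [abs_pow, abs_norm]; exact pow_le_pow_left₀ (norm_nonneg _) (hf.bound_grad x) 2

lemma BddC1.avg_poincare {f : Space d → ℝ} {K : ℝ} (hf : BddC1 f K) {t : ℝ} (ht : 0 ≤ t)
    (x : Space d) :
    avg √t (fun x => f x ^ 2) x - avg √t f x ^ 2 ≤ t * avg √t (fun x => ‖∇ f x‖ ^ 2) x := by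
  have h := poincare_stdGaussian (hf.comp_affine √t x).1
  rw [(hf.comp_affine √t x).2] at h
  simp_rw [norm_smul, mul_pow, Real.norm_eq_abs, sq_abs, Real.sq_sqrt ht] at h
  rwa [integral_const_mul] at h

lemma BddC1.avg_log_sobolev {f : Space d → ℝ} {K m : ℝ} (hf : BddC1 f K) (hm : 0 < m)
    (hfm : ∀ x, m ≤ f x) {t : ℝ} (ht : 0 ≤ t) (x : Space d) :
    ent (stdGaussian (Space d)) (fun z => f (x + √t • z)) ≤
      t / 2 * avg √t (fun x => ‖∇ f x‖ ^ 2 / f x) x := by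
  have h := log_sobolev_stdGaussian (hf.comp_affine √t x).1 hm fun _ => hfm _
  rw [(hf.comp_affine √t x).2] at h
  simp_rw [norm_smul, mul_pow, Real.norm_eq_abs, sq_abs, Real.sq_sqrt ht, mul_div_assoc] at h
  rw [integral_const_mul] at h
  refine h.trans (le_of_eq ?_)
  rw [avg]; ring

variable (μ : Measure (Space d)) [IsProbabilityMeasure μ]

/-- The variance between components is at most `M - 1` times the mean variance within components, so
the total is at most `M` times the latter. -/
theorem poincare_conv {f : Space d → ℝ} {K : ℝ} (hf : BddC1 f K) {t : ℝ} (ht : 0 < t)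
    (hint : Integrable (fun p : Space d × Space d => Real.exp (‖p.1 - p.2‖ ^ 2 / t))
      (μ.prod μ)) :
    ∫ x, f x ^ 2 ∂(μ.conv (gaussian d t)) - (∫ x, f x ∂(μ.conv (gaussian d t))) ^ 2 ≤
      t * (∫ p : Space d × Space d, Real.exp (‖p.1 - p.2‖ ^ 2 / t) ∂(μ.prod μ)) *
        ∫ x, ‖∇ f x‖ ^ 2 ∂(μ.conv (gaussian d t)) := by
  have hc := hf.continuous
  have hc' := hf.continuous_grad
  have hc2 : Continuous fun x => f x ^ 2 := by fun_prop
  have hcg : Continuous fun x => ‖∇ f x‖ ^ 2 := by fun_prop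
  have hs : √t ≠ 0 := (Real.sqrt_pos.2 ht).ne'
  rw [integral_conv_gaussian μ ht.le hc2 hf.abs_sq_le, integral_conv_gaussian μ ht.le hc hf.bound,
    integral_conv_gaussian μ ht.le hcg hf.abs_sq_grad_le]
  set s := √t
  have hh := continuous_avg hc hf.bound s
  have hh2 := continuous_avg hc2 hf.abs_sq_le s
  have hhg := continuous_avg hcg hf.abs_sq_grad_le s
  have ih : Integrable (avg s f) μ := integrable_of_continuous_of_bound hh (abs_avg_le hf.bound s)
  have ih2 : Integrable (avg s fun x => f x ^ 2) μ :=
    integrable_of_continuous_of_bound hh2 (abs_avg_le hf.abs_sq_le s)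
  have ihg : Integrable (avg s fun x => ‖∇ f x‖ ^ 2) μ :=
    integrable_of_continuous_of_bound hhg (abs_avg_le hf.abs_sq_grad_le s)
  have ihsq : Integrable (fun x => avg s f x ^ 2) μ :=
    integrable_of_continuous_of_bound (K := K ^ 2) (by fun_prop) fun x => by
      rw [norm_pow]; exact pow_le_pow_left₀ (norm_nonneg _) (abs_avg_le hf.bound s x) 2
  set a : Space d → ℝ := fun x => avg s (fun x => f x ^ 2) x - avg s f x ^ 2 with ha
  set φ : Space d → ℝ := fun x' => ∫ x, (Real.exp (‖x - x'‖ ^ 2 / t) - 1) ∂μ with hφ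
  set M := ∫ p : Space d × Space d, Real.exp (‖p.1 - p.2‖ ^ 2 / t) ∂(μ.prod μ)
  have hpair : ∀ x x', (avg s f x - avg s f x') ^ 2 ≤
      a x' * (Real.exp (‖x - x'‖ ^ 2 / t) - 1) := fun x x' => by
    have := sq_integral_add_sub_le (H := fun z => f (x' + s • z)) (by fun_prop)
      (fun _ => hf.bound _) (s⁻¹ • (x - x'))
    rwa [← avg_eq_integral_add hs, norm_inv_sqrt_smul_sq ht.le] at this
  have ia : Integrable a μ := ih2.sub ihsq
  have ia_le : ∫ x, a x ∂μ ≤ t * ∫ x, avg s (fun x => ‖∇ f x‖ ^ 2) x ∂μ := by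
    rw [← integral_const_mul]
    exact integral_mono ia (ihg.const_mul t) fun x => hf.avg_poincare ht.le x
  have ha0 : ∀ x, 0 ≤ a x := fun x =>
    sub_nonneg.2 (sq_integral_le (integrable_avg hc hf.bound s x)
      (integrable_avg hc2 hf.abs_sq_le s x))
  set v := ∫ x, avg s f x ^ 2 ∂μ - (∫ x, avg s f x ∂μ) ^ 2
  have hint1 : Integrable (fun p : Space d × Space d => Real.exp (‖p.1 - p.2‖ ^ 2 / t) - 1)
      (μ.prod μ) := hint.sub (integrable_const _)
  -- The mean square deviation of `u` from `u(x')` is least when `u(x')` is its mean, so it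
  -- dominates `v`.
  have hv : ∀ᵐ x' ∂μ, v ≤ a x' * φ x' := by
    filter_upwards [hint1.prod_left_ae] with x' hx'
    have h1 := integral_mono (f := fun x => (avg s f x - avg s f x') ^ 2)
      (integrable_of_continuous_of_bound (K := (2 * K) ^ 2) (by fun_prop) fun x => by
        rw [norm_pow]
        refine pow_le_pow_left₀ (norm_nonneg _) ((norm_sub_le _ _).trans ?_) 2
        linarith [abs_avg_le hf.bound s x, abs_avg_le hf.bound s x',
          Real.norm_eq_abs (avg s f x), Real.norm_eq_abs (avg s f x')])
      (hx'.const_mul (a x')) (fun x => hpair x x')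
    rw [integral_const_mul, integral_sub_const_sq ih ihsq] at h1
    refine le_trans ?_ h1
    simp only [v]
    nlinarith [sq_nonneg (∫ x, avg s f x ∂μ - avg s f x')]
  have iφ : Integrable φ μ := hint1.integral_prod_right
  have hφint : ∫ x', φ x' ∂μ = M - 1 := by
    simp only [hφ]
    rw [← integral_prod_symm _ hint1, integral_sub hint (integrable_const _)]
    simp [M]
  have hv0 : 0 ≤ v := sub_nonneg.2 (sq_integral_le ih ihsq)
  -- Cauchy–Schwarz for `√v ≤ √a √φ` without roots: `a r² - 2vr + vφ` is nonnegative because `v² ≤ a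
  -- · vφ`. The discriminant of the integrated form gives `v² ≤ v (M-1) ∫ a`.
  have key : ∀ r : ℝ, 0 ≤ (∫ x, a x ∂μ) * (r * r) + (-2 * v) * r + v * (M - 1) := by
    intro r
    have h0 : 0 ≤ ∫ x', (a x' * (r * r) + (-2 * v) * r + v * φ x') ∂μ := by
      refine integral_nonneg_of_ae ?_
      filter_upwards [hv] with x' hx'
      simp only [Pi.zero_apply]
      rcases (ha0 x').eq_or_lt with h | h
      · rw [← h, zero_mul] at hx'
        have : v = 0 := le_antisymm hx' hv0
        rw [this, ← h]; simp
      · have h4 : 0 ≤ a x' * (a x' * (r * r) + (-2 * v) * r + v * φ x') := by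
          nlinarith [sq_nonneg (a x' * r - v), mul_nonneg hv0 (sub_nonneg.2 hx')]
        exact nonneg_of_mul_nonneg_right h4 h
    rwa [integral_add (f := fun x => a x * (r * r) + (-2 * v) * r)
      ((ia.mul_const _).add (integrable_const _)) (iφ.const_mul _),
      integral_add (ia.mul_const _) (integrable_const _), integral_mul_const, integral_const,
      integral_const_mul, hφint, probReal_univ, one_smul] at h0
  have hdisc := discrim_le_zero key
  rw [discrim] at hdisc
  have hA0 : 0 ≤ ∫ x, a x ∂μ := integral_nonneg ha0
  have hM1 : 0 ≤ M - 1 := by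
    rw [← hφint]
    refine integral_nonneg fun x' => integral_nonneg fun x => ?_
    simpa using Real.one_le_exp (by positivity : 0 ≤ ‖x - x'‖ ^ 2 / t)
  have hvle : v ≤ (∫ x, a x ∂μ) * (M - 1) := by
    rcases hv0.eq_or_lt with h | h
    · rw [← h]; positivity
    · refine le_of_mul_le_mul_left ?_ h
      nlinarith
  have hsum : ∫ x, avg s (fun x => f x ^ 2) x ∂μ = ∫ x, a x ∂μ + ∫ x, avg s f x ^ 2 ∂μ := by
    simp only [ha]
    rw [integral_sub ih2 ihsq]; ring
  have hfin : ∫ x, avg s (fun x => f x ^ 2) x ∂μ - (∫ x, avg s f x ∂μ) ^ 2 ≤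
      M * ∫ x, a x ∂μ := by
    rw [hsum]
    simp only [v] at hvle
    linarith
  refine hfin.trans ?_
  calc _ ≤ M * (t * ∫ x, avg s (fun x => ‖∇ f x‖ ^ 2) x ∂μ) :=
        mul_le_mul_of_nonneg_left ia_le (by linarith)
    _ = _ := by ring

end Mixture

/-! ### The defective log-Sobolev inequality. -/

section DefectiveLogSobolev

variable {d : ℕ} (μ : Measure (Space d)) [IsProbabilityMeasure μ]

/-- Young's inequality for the dual pair `α log α - α` and `exp`, normalised by `C`; integrated, it
is the Donsker–Varadhan bound. -/
lemma mul_sub_log_le {α S C : ℝ} (hα : 0 < α) (hC : 0 < C) :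
    α * (S - Real.log C) ≤ α * Real.log α - α + Real.exp S / C := by
  have h := Real.log_le_sub_one_of_pos (x := Real.exp S / C / α) (by positivity)
  rw [Real.log_div (by positivity) hα.ne', Real.log_div (by positivity) hC.ne', Real.log_exp] at h
  have h2 := mul_le_mul_of_nonneg_left h hα.le
  have h3 : α * (Real.exp S / C / α - 1) = Real.exp S / C - α := by field_simp
  rw [h3] at h2
  linarith

/-- A defective logarithmic Sobolev inequality for Gaussian convolutions. -/
theorem defective_log_sobolev_conv {F : Space d → ℝ} {K m : ℝ} (hF : BddC1 F K) (hm : 0 < m)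
    (hFm : ∀ x, m ≤ F x) {t v C : ℝ} (hv : 0 < v) (hvt : v < t) (hC : 0 < C)
    (hint : Integrable (fun p : Space d × Space d => Real.exp (‖p.1 - p.2‖ ^ 2 / v)) (μ.prod μ))
    (hle : ∫ p : Space d × Space d, Real.exp (‖p.1 - p.2‖ ^ 2 / v) ∂(μ.prod μ) ≤ C) :
    (1 - v / t) * ent (μ.conv (gaussian d t)) F ≤
      (2 - v / t) * (t / 2 * ∫ x, ‖∇ F x‖ ^ 2 / F x ∂(μ.conv (gaussian d t))) +
        v / t * Real.log C * ∫ x, F x ∂(μ.conv (gaussian d t)) := by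
  have ht : 0 < t := hv.trans hvt
  have hr1 : v / t < 1 := (div_lt_one ht).2 hvt
  have hc := hF.continuous
  have hc' := hF.continuous_grad
  have hpos : ∀ x, 0 < F x := fun x => hm.trans_le (hFm x)
  have hFI : ∀ x, F x ∈ Icc m K := fun x => ⟨hFm x, (le_abs_self _).trans (hF.bound x)⟩
  have hs : √t ≠ 0 := (Real.sqrt_pos.2 ht).ne'
  obtain ⟨A, hA⟩ := isCompact_Icc.exists_bound_of_continuousOn
    (s := Icc m K) (f := fun u => u * Real.log u) Real.continuous_mul_log.continuousOn
  have hlc : Continuous fun x => F x * Real.log (F x) := Real.continuous_mul_log.comp hc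
  have hlb : ∀ x, |F x * Real.log (F x)| ≤ A := fun x => hA _ (hFI x)
  have hgc : Continuous fun x => ‖∇ F x‖ ^ 2 / F x :=
    (hc'.norm.pow 2).div hc fun x => (hpos x).ne'
  have hgb : ∀ x, |‖∇ F x‖ ^ 2 / F x| ≤ K ^ 2 / m := fun x => by
    rw [abs_div, abs_of_pos (hpos x)]
    exact div_le_div₀ (sq_nonneg _) (hF.abs_sq_grad_le x) hm (hFm x)
  rw [ent, integral_conv_gaussian μ ht.le hlc hlb, integral_conv_gaussian μ ht.le hc hF.bound,
    integral_conv_gaussian μ ht.le hgc hgb]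
  set s := √t
  set u := avg s F with hu
  have huc : Continuous u := continuous_avg hc hF.bound s
  have hub : ∀ x, |u x| ≤ K := abs_avg_le hF.bound s
  have hum : ∀ x, m ≤ u x := fun x => by
    simpa [hu, avg] using avg_mono (F := fun _ => m) (K := |m|) continuous_const
      (fun _ => le_rfl) hc hF.bound hFm s x
  have hupos : ∀ x, 0 < u x := fun x => hm.trans_le (hum x)
  have huI : ∀ x, u x ∈ Icc m K := fun x => ⟨hum x, (le_abs_self _).trans (hub x)⟩
  set N : Space d → ℝ := fun x => u x * Real.log (u x) with hN
  have hNc : Continuous N := Real.continuous_mul_log.comp huc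
  have hNb : ∀ x, |N x| ≤ A := fun x => hA _ (huI x)
  set e : Space d → ℝ := fun x => avg s (fun x => F x * Real.log (F x)) x - N x with he
  have iu : Integrable u μ := integrable_of_continuous_of_bound huc hub
  have iN : Integrable N μ := integrable_of_continuous_of_bound hNc hNb
  have il : Integrable (avg s (fun x => F x * Real.log (F x))) μ :=
    integrable_of_continuous_of_bound (continuous_avg hlc hlb s) (abs_avg_le hlb s)
  have ig : Integrable (avg s (fun x => ‖∇ F x‖ ^ 2 / F x)) μ :=
    integrable_of_continuous_of_bound (continuous_avg hgc hgb s) (abs_avg_le hgb s)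
  have ie : Integrable e μ := il.sub iN
  have ie_le : ∫ x, e x ∂μ ≤ t / 2 * ∫ x, avg s (fun x => ‖∇ F x‖ ^ 2 / F x) x ∂μ := by
    rw [← integral_const_mul]
    exact integral_mono ie (ig.const_mul _) fun x => hF.avg_log_sobolev hm hFm ht.le x
  set U := ∫ x, u x ∂μ with hU
  have hUpos : 0 < U := hm.trans_le (by
    simpa using integral_mono (integrable_const (μ := μ) m) iu hum)
  set I := ∫ p : Space d × Space d, u p.1 * (‖p.1 - p.2‖ ^ 2 / v) ∂(μ.prod μ) with hI
  have iI : Integrable (fun p : Space d × Space d => u p.1 * (‖p.1 - p.2‖ ^ 2 / v))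
      (μ.prod μ) := by
    refine (hint.const_mul K).mono' (Continuous.aestronglyMeasurable (by fun_prop))
      (ae_of_all _ fun p => ?_)
    rw [norm_mul, Real.norm_of_nonneg (by positivity : 0 ≤ ‖p.1 - p.2‖ ^ 2 / v)]
    refine mul_le_mul (hub _) ?_ (by positivity) hF.nonneg
    linarith [Real.add_one_le_exp (‖p.1 - p.2‖ ^ 2 / v)]
  have iN1 := iN.comp_fst μ
  have iu1 := iu.comp_fst μ
  have ie1 := ie.comp_fst μ
  have iuu : Integrable (fun p : Space d × Space d => u p.1 * u p.2) (μ.prod μ) :=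
    iu.mul_prod iu
  have hNfst : ∫ p : Space d × Space d, N p.1 ∂(μ.prod μ) = ∫ x, N x ∂μ := by
    simp [integral_fun_fst]
  have hufst : ∫ p : Space d × Space d, u p.1 ∂(μ.prod μ) = U := by
    simp [integral_fun_fst, hU]
  have hefst : ∫ p : Space d × Space d, e p.1 ∂(μ.prod μ) = ∫ x, e x ∂μ := by
    simp [integral_fun_fst]
  have huufst : ∫ p : Space d × Space d, u p.1 * u p.2 ∂(μ.prod μ) = U * U :=
    integral_prod_mul u u
  -- The Harnack-type bound averaged over `x'`; `∫ log u dμ ≤ log U` enters through the tangent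
  -- `log(u(x')/U) ≤ u(x')/U - 1`.
  have step1 : ∫ x, N x ∂μ - U * Real.log U ≤ ∫ x, e x ∂μ + v / t * I := by
    have hpt : ∀ p : Space d × Space d, N p.1 - Real.log U * u p.1 ≤
        e p.1 + v / t * (u p.1 * (‖p.1 - p.2‖ ^ 2 / v)) +
          (U⁻¹ * (u p.1 * u p.2) - u p.1) := by
      rintro ⟨x, x'⟩
      simp only
      have h1 := mul_log_div_le (H := fun z => F (x + s • z)) (by fun_prop) hm (fun _ => hFm _)
        (fun _ => (hFI _).2) (s⁻¹ • (x' - x))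
      rw [← avg_eq_integral_add hs, norm_inv_sqrt_smul_sq ht.le, norm_sub_rev] at h1
      change u x * (Real.log (u x) - Real.log (u x')) ≤ e x + u x * (‖x - x'‖ ^ 2 / t) at h1
      have h2 := Real.log_le_sub_one_of_pos (x := u x' / U) (div_pos (hupos x') hUpos)
      rw [Real.log_div (hupos x').ne' hUpos.ne'] at h2
      have h3 := mul_le_mul_of_nonneg_left h2 (hupos x).le
      have h4 : v / t * (u x * (‖x - x'‖ ^ 2 / v)) = u x * (‖x - x'‖ ^ 2 / t) := by
        field_simp
      rw [h4]
      simp only [hN]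
      have h5 : U⁻¹ * (u x * u x') = u x * (u x' / U) := by ring
      rw [h5]
      linarith
    have h := integral_mono (iN1.sub (iu1.const_mul (Real.log U)))
      ((ie1.add (iI.const_mul (v / t))).add ((iuu.const_mul U⁻¹).sub iu1)) hpt
    rw [integral_sub' iN1 (iu1.const_mul _), integral_add' (ie1.add (iI.const_mul (v / t)))
      ((iuu.const_mul U⁻¹).sub iu1), integral_add' ie1 (iI.const_mul (v / t)),
      integral_sub' (iuu.const_mul U⁻¹) iu1, integral_const_mul, integral_const_mul,
      integral_const_mul, hNfst, hufst, hefst, huufst, ← hI, inv_mul_cancel_left₀ hUpos.ne'] at h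
    linarith
  -- Entropy duality on `μ ⊗ μ` for the density `u(x)/U` and the exponent `‖x-x'‖²/v`.
  have step2 : I ≤ (∫ x, N x ∂μ - U * Real.log U) + U * Real.log C := by
    have hpt : ∀ p : Space d × Space d,
        U⁻¹ * (u p.1 * (‖p.1 - p.2‖ ^ 2 / v)) - Real.log C * U⁻¹ * u p.1 ≤
        (U⁻¹ * N p.1 - (Real.log U * U⁻¹ + U⁻¹) * u p.1) +
          C⁻¹ * Real.exp (‖p.1 - p.2‖ ^ 2 / v) := by
      intro p
      have h1 := mul_sub_log_le (S := ‖p.1 - p.2‖ ^ 2 / v) (div_pos (hupos p.1) hUpos) hC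
      rw [Real.log_div (hupos p.1).ne' hUpos.ne'] at h1
      simp only [hN]
      refine le_trans (le_of_eq ?_) (h1.trans (le_of_eq ?_)) <;> ring
    have h := integral_mono ((iI.const_mul U⁻¹).sub (iu1.const_mul (Real.log C * U⁻¹)))
      (((iN1.const_mul U⁻¹).sub (iu1.const_mul (Real.log U * U⁻¹ + U⁻¹))).add
        (hint.const_mul C⁻¹)) hpt
    rw [integral_sub' (iI.const_mul U⁻¹) (iu1.const_mul _),
      integral_add' ((iN1.const_mul U⁻¹).sub (iu1.const_mul _)) (hint.const_mul C⁻¹),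
      integral_sub' (iN1.const_mul U⁻¹) (iu1.const_mul _), integral_const_mul, integral_const_mul,
      integral_const_mul, integral_const_mul, integral_const_mul, hNfst, hufst, ← hI] at h
    have h2 : C⁻¹ * ∫ p : Space d × Space d, Real.exp (‖p.1 - p.2‖ ^ 2 / v) ∂(μ.prod μ) ≤ 1 :=
      (inv_mul_le_one₀ hC).2 hle
    have h3 : U⁻¹ * I ≤ U⁻¹ * ((∫ x, N x ∂μ - U * Real.log U) + U * Real.log C) := by
      have e1 : Real.log C * U⁻¹ * U = Real.log C := by field_simp
      have e2 : (Real.log U * U⁻¹ + U⁻¹) * U = Real.log U + 1 := by field_simp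
      have e3 : U⁻¹ * ((∫ x, N x ∂μ - U * Real.log U) + U * Real.log C) =
          U⁻¹ * ∫ x, N x ∂μ - Real.log U + Real.log C := by field_simp
      rw [e3]
      rw [e1, e2] at h
      linarith
    exact le_of_mul_le_mul_left h3 (inv_pos.2 hUpos)
  have hsum : ∫ x, avg s (fun x => F x * Real.log (F x)) x ∂μ = ∫ x, e x ∂μ + ∫ x, N x ∂μ := by
    simp only [he]
    rw [integral_sub il iN]; ring
  rw [hsum]
  have hr0 : 0 < v / t := div_pos hv ht
  -- With `r = v/t`, the two steps give `(1-r) J ≤ ∫ e + r U log C`. Adding `(1-r) ∫ e` produces the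
  -- factor `2 - r`.
  have h1 := mul_le_mul_of_nonneg_left step2 hr0.le
  have h2 := mul_le_mul_of_nonneg_left ie_le (by linarith : 0 ≤ 2 - v / t)
  nlinarith

end DefectiveLogSobolev

/-! ### Rothaus-type tightening and removal of the lower bound. -/

section Tightening

lemma one_add_sq_le_exp {w : ℝ} (hw : 0 ≤ w) : 1 + w ^ 2 ≤ Real.exp w := by
  have h := Real.sum_le_exp_of_nonneg hw 4
  simp only [Finset.sum_range_succ, Finset.range_zero, Finset.sum_empty, Nat.factorial] at h
  norm_num at h
  nlinarith [mul_nonneg hw (sq_nonneg (w - 3 / 2))]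

/-- Arranged for integration with `∫ g = 0` and `S = ∫ g²`: the linear term vanishes and the terms
with `log S` and `log(c² + S)` become the entropy normalisations. The `6` is `4` from expanding the
square (`h1`) plus `2` from replacing `log q` by `log c²` in the cross term (`h5`). -/
lemma sq_mul_log_sq_le {c g S : ℝ} (hc : c ≠ 0) (hS : 0 < S) :
    (c + g) ^ 2 * Real.log ((c + g) ^ 2) ≤ g ^ 2 * Real.log (g ^ 2) - Real.log S * g ^ 2 +
      Real.log (c ^ 2 + S) * (c ^ 2 + g ^ 2) + (2 * c * Real.log (c ^ 2) + 2 * c) * g +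
      6 * g ^ 2 := by
  have hc2 : 0 < c ^ 2 := by positivity
  set q := c ^ 2 + g ^ 2 with hq
  have hqpos : 0 < q := by positivity
  have h1 : (c + g) ^ 2 * Real.log ((c + g) ^ 2) ≤
      q * Real.log q + 2 * (c * g) * Real.log q + 2 * (c * g) + 4 * g ^ 2 := by
    have hz : (c + g) ^ 2 = q + 2 * (c * g) := by rw [hq]; ring
    have h2 : (c + g) ^ 2 * Real.log ((c + g) ^ 2) ≤
        (c + g) ^ 2 * (Real.log q + 2 * (c * g) / q) := by
      rcases (sq_nonneg (c + g)).eq_or_lt with h | h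
      · rw [← h]; simp
      · refine mul_le_mul_of_nonneg_left ?_ h.le
        have := Real.log_le_sub_one_of_pos (x := (c + g) ^ 2 / q) (by positivity)
        rw [Real.log_div h.ne' hqpos.ne', hz] at this
        rw [hz]
        have e : (q + 2 * (c * g)) / q - 1 = 2 * (c * g) / q := by field_simp; ring
        linarith
    refine h2.trans ?_
    rw [hz]
    have h3 : (q + 2 * (c * g)) * (Real.log q + 2 * (c * g) / q) = q * Real.log q +
        2 * (c * g) * Real.log q + 2 * (c * g) + 4 * (c ^ 2 * g ^ 2 / q) := by
      field_simp; ring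
    have h4 : c ^ 2 * g ^ 2 / q ≤ g ^ 2 := by
      rw [div_le_iff₀ hqpos, hq]; nlinarith [sq_nonneg (g ^ 2)]
    linarith
  have h5 : 2 * (c * g) * Real.log q ≤ 2 * (c * g) * Real.log (c ^ 2) + 2 * g ^ 2 := by
    have h6 : Real.log q - Real.log (c ^ 2) ≤ |g / c| := by
      rw [← Real.log_div hqpos.ne' hc2.ne', Real.log_le_iff_le_exp (by positivity)]
      have := one_add_sq_le_exp (abs_nonneg (g / c))
      rw [sq_abs] at this
      refine le_trans (le_of_eq ?_) this
      rw [hq]; field_simp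
    have h7 : 0 ≤ Real.log q - Real.log (c ^ 2) :=
      sub_nonneg.2 (Real.log_le_log hc2 (by rw [hq]; nlinarith [sq_nonneg g]))
    have h8 : c * g * (Real.log q - Real.log (c ^ 2)) ≤ |c * g| * |g / c| :=
      mul_le_mul (le_abs_self _) h6 h7 (abs_nonneg _)
    rw [← abs_mul] at h8
    have h9 : c * g * (g / c) = g ^ 2 := by field_simp
    rw [h9, abs_of_nonneg (sq_nonneg g)] at h8
    linarith
  -- The log-sum inequality for the pairs `(c², c²)` and `(g², S)`.
  have h10 : q * Real.log q ≤ g ^ 2 * Real.log (g ^ 2) - Real.log S * g ^ 2 +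
      Real.log (c ^ 2 + S) * q := by
    have hcS : 0 < c ^ 2 + S := by positivity
    have l1 := Real.one_sub_inv_le_log_of_pos (x := (c ^ 2 + S) / q) (by positivity)
    rw [Real.log_div hcS.ne' hqpos.ne', inv_div] at l1
    have l2 : g ^ 2 - S * (q / (c ^ 2 + S)) ≤ g ^ 2 * (Real.log (g ^ 2) - Real.log S +
        (Real.log (c ^ 2 + S) - Real.log q)) := by
      rcases (sq_nonneg g).eq_or_lt with h | h
      · rw [← h, zero_mul, zero_sub]
        have : 0 ≤ S * (q / (c ^ 2 + S)) := by positivity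
        linarith
      · have l3 := Real.one_sub_inv_le_log_of_pos (x := g ^ 2 / S * ((c ^ 2 + S) / q))
          (by positivity)
        rw [Real.log_mul (by positivity) (by positivity), Real.log_div h.ne' hS.ne',
          Real.log_div hcS.ne' hqpos.ne'] at l3
        have l4 := mul_le_mul_of_nonneg_left l3 h.le
        refine le_trans (le_of_eq ?_) l4
        have hg0 : g ≠ 0 := by rintro rfl; simp at h
        field_simp
    have l5 := mul_le_mul_of_nonneg_left l1 hc2.le
    have l6 : c ^ 2 * (1 - q / (c ^ 2 + S)) + (g ^ 2 - S * (q / (c ^ 2 + S))) = 0 := by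
      field_simp
      rw [hq]; ring
    have l7 : q * (Real.log (c ^ 2 + S) - Real.log q) =
        c ^ 2 * (Real.log (c ^ 2 + S) - Real.log q) +
        g ^ 2 * (Real.log (c ^ 2 + S) - Real.log q) := by rw [hq]; ring
    nlinarith
  linarith

variable {d : ℕ} {ρ : Measure (Space d)} [IsProbabilityMeasure ρ]

/-- A weak form of Rothaus' lemma. -/
theorem ent_sq_const_add_le {g : Space d → ℝ} {K : ℝ} (hg : Continuous g) (hK : ∀ x, |g x| ≤ K)
    (h0 : ∫ x, g x ∂ρ = 0) (c : ℝ) :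
    ent ρ (fun x => (c + g x) ^ 2) ≤ ent ρ (fun x => g x ^ 2) + 6 * ∫ x, g x ^ 2 ∂ρ := by
  have hnn : 0 ≤ ∫ x, g x ^ 2 ∂ρ := integral_nonneg fun x => sq_nonneg _
  rcases eq_or_ne c 0 with rfl | hc
  · simp only [zero_add]; linarith
  have hsqb : ∀ x, |g x ^ 2| ≤ K ^ 2 := fun x => by
    rw [abs_pow]; exact pow_le_pow_left₀ (abs_nonneg _) (hK x) 2
  have ig : Integrable g ρ := integrable_of_continuous_of_bound hg hK
  have ig2 : Integrable (fun x => g x ^ 2) ρ :=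
    integrable_of_continuous_of_bound (by fun_prop) hsqb
  have hlog : ∀ {k : Space d → ℝ} {B : ℝ}, Continuous k → (∀ x, |k x| ≤ B) →
      Integrable (fun x => k x * Real.log (k x)) ρ := fun {k B} hk hB => by
    obtain ⟨A, hA⟩ := isCompact_Icc.exists_bound_of_continuousOn
      (s := Icc (-B) B) (f := fun u => u * Real.log u) Real.continuous_mul_log.continuousOn
    exact integrable_of_continuous_of_bound (Real.continuous_mul_log.comp hk)
      fun x => hA (k x) (abs_le.1 (hB x))
  set S := ∫ x, g x ^ 2 ∂ρ with hS
  have hsq : ∫ x, (c + g x) ^ 2 ∂ρ = c ^ 2 + S := by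
    have h := integral_sub_const_sq ig ig2 (-c)
    rw [h0] at h
    simp only [sub_neg_eq_add, mul_zero, sub_zero, neg_sq] at h
    simp_rw [add_comm c, h]
    ring
  rcases hnn.eq_or_lt with hz | hpos
  · have hae : g =ᵐ[ρ] 0 := by
      have := (integral_eq_zero_iff_of_nonneg (fun x => sq_nonneg (g x)) ig2).1 hz.symm
      filter_upwards [this] with x hx
      simpa using hx
    have e1 : ∫ x, (c + g x) ^ 2 * Real.log ((c + g x) ^ 2) ∂ρ = c ^ 2 * Real.log (c ^ 2) := by
      rw [integral_congr_ae (g := fun _ => c ^ 2 * Real.log (c ^ 2))]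
      · simp
      · filter_upwards [hae] with x hx
        simp [hx]
    have e2 : ∫ x, g x ^ 2 * Real.log (g x ^ 2) ∂ρ = 0 := by
      rw [integral_congr_ae (g := fun _ => (0 : ℝ))]
      · simp
      · filter_upwards [hae] with x hx
        simp [hx]
    simp only [ent]
    rw [e1, e2, hsq, ← hS, ← hz]
    simp
  · have hcg : ∀ x, |(c + g x) ^ 2| ≤ (|c| + K) ^ 2 := fun x => by
      rw [abs_pow]
      exact pow_le_pow_left₀ (abs_nonneg _) ((abs_add_le _ _).trans (by linarith [hK x])) 2
    have i1 := hlog (k := fun x => (c + g x) ^ 2) (by fun_prop) hcg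
    have i2 := hlog (k := fun x => g x ^ 2) (by fun_prop) hsqb
    have i3 := ig2.const_mul (Real.log S)
    have i4 := ((integrable_const (μ := ρ) (c ^ 2)).add ig2).const_mul (Real.log (c ^ 2 + S))
    have i5 := ig.const_mul (2 * c * Real.log (c ^ 2) + 2 * c)
    have i6 := ig2.const_mul 6
    have h := integral_mono i1 ((((i2.sub i3).add i4).add i5).add i6)
      fun x => sq_mul_log_sq_le (g := g x) hc hpos
    rw [integral_add' (((i2.sub i3).add i4).add i5) i6, integral_add' ((i2.sub i3).add i4) i5,
      integral_add' (i2.sub i3) i4, integral_sub' i2 i3, integral_const_mul, integral_const_mul,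
      integral_const_mul, integral_const_mul, integral_add' (integrable_const _) ig2, h0,
      integral_const, ← hS] at h
    simp only [probReal_univ, one_smul, mul_zero, add_zero] at h
    simp only [ent]
    rw [hsq, ← hS]
    linarith

lemma mul_log_add_le {x ε : ℝ} (hx : 0 ≤ x) (hε : 0 < ε) :
    x * Real.log x + ε * Real.log ε ≤ (x + ε) * Real.log (x + ε) := by
  have h1 : Real.log ε ≤ Real.log (x + ε) := Real.log_le_log hε (by linarith)
  rcases hx.eq_or_lt with rfl | h
  · simp
  · have h2 : Real.log x ≤ Real.log (x + ε) := Real.log_le_log h (by linarith)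
    nlinarith

/-- Superadditivity of `x log x` up to the constant `ε log ε` bounds the entropy of `F` by that of
`F + ε` plus an explicit error tending to `0`, so no limit is taken under the integral. -/
lemma ent_le_of_forall_add {F : Space d → ℝ} {K a A B : ℝ} (hF : Continuous F)
    (hF0 : ∀ x, 0 ≤ F x) (hK : ∀ x, |F x| ≤ K) (ha : 0 ≤ a)
    (h : ∀ ε > 0, a * ent ρ (fun x => F x + ε) ≤ A + B * ∫ x, F x + ε ∂ρ) :
    a * ent ρ F ≤ A + B * ∫ x, F x ∂ρ := by
  have iF : Integrable F ρ := integrable_of_continuous_of_bound hF hK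
  have hlog : ∀ ε : ℝ, Integrable (fun x => (F x + ε) * Real.log (F x + ε)) ρ := fun ε => by
    obtain ⟨A, hA⟩ := isCompact_Icc.exists_bound_of_continuousOn
      (s := Icc (-(K + |ε|)) (K + |ε|)) (f := fun u => u * Real.log u)
      Real.continuous_mul_log.continuousOn
    exact integrable_of_continuous_of_bound
      (Real.continuous_mul_log.comp (hF.add continuous_const))
      fun x => hA (F x + ε) (abs_le.1 ((abs_add_le _ _).trans (by linarith [hK x])))
  set M := ∫ x, F x ∂ρ with hM
  have hadd : ∀ ε : ℝ, ∫ x, F x + ε ∂ρ = M + ε := fun ε => by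
    rw [integral_add iF (integrable_const _)]; simp [hM]
  have hle : ∀ ε > 0, a * ent ρ F ≤ A + B * (M + ε) + a * ((M + ε) * Real.log (M + ε) -
      M * Real.log M - ε * Real.log ε) := by
    intro ε hε
    have h1 := h ε hε
    rw [ent, hadd] at h1
    have i0 : Integrable (fun x => F x * Real.log (F x)) ρ := by simpa using hlog 0
    have h2 := integral_mono (i0.add (integrable_const (ε * Real.log ε))) (hlog ε)
      fun x => mul_log_add_le (hF0 x) hε
    rw [integral_add' i0 (integrable_const _), integral_const] at h2
    simp only [probReal_univ, one_smul] at h2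
    rw [ent, ← hM]
    nlinarith [mul_le_mul_of_nonneg_left h2 ha]
  have hcont : Continuous fun ε : ℝ => A + B * (M + ε) + a * ((M + ε) * Real.log (M + ε) -
      M * Real.log M - ε * Real.log ε) := by
    have c1 : Continuous fun ε : ℝ => (M + ε) * Real.log (M + ε) :=
      Real.continuous_mul_log.comp (continuous_const.add continuous_id)
    have c2 := Real.continuous_mul_log
    fun_prop
  have htend := (hcont.tendsto 0).mono_left (nhdsWithin_le_nhds (s := Ioi (0 : ℝ)))
  simp only [add_zero, zero_mul, sub_self, mul_zero] at htend
  exact ge_of_tendsto htend (eventually_mem_nhdsWithin.mono fun ε hε => hle ε hε)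

end Tightening

/-! ### Sub-Gaussian tails and assembly of the constants. -/

section Conclusion

variable {d : ℕ}

lemma IsTest.exists_bddC1 {f : Space d → ℝ} (hf : IsTest f) : ∃ K, BddC1 f K := by
  obtain ⟨B0, hB0⟩ := hf.2 0
  obtain ⟨B1, hB1⟩ := hf.2 1
  have hd : Differentiable ℝ f := hf.1.differentiable (by simp)
  refine ⟨max B0 B1, fun x => ?_, ?_, fun x => ?_, fun x => ?_⟩
  · exact (hd x).hasGradientAt.hasFDerivAt
  · exact (LinearIsometryEquiv.continuous _).comp (hf.1.continuous_fderiv (by simp))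
  · have := hB0 x
    rw [norm_iteratedFDeriv_zero] at this
    exact this.trans (le_max_left _ _)
  · have := hB1 x
    rw [norm_iteratedFDeriv_one] at this
    rw [gradient, LinearIsometryEquiv.norm_map]
    exact this.trans (le_max_right _ _)

lemma BddC1.sub_const {f : Space d → ℝ} {K : ℝ} (hf : BddC1 f K) (c : ℝ) :
    BddC1 (fun x => f x - c) (K + |c|) ∧ ∇ (fun x => f x - c) = ∇ f :=
  BddC1.of_hasFDerivAt (fun x => (hf.hasFDerivAt x).sub_const c) hf.continuous_grad
    (fun x => (abs_sub _ _).trans (by linarith [hf.bound x]))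
    (fun x => (hf.bound_grad x).trans (by linarith [abs_nonneg c]))

lemma BddC1.sq_add_const {f : Space d → ℝ} {K : ℝ} (hf : BddC1 f K) (c : ℝ) :
    BddC1 (fun x => f x ^ 2 + c) (2 * K ^ 2 + |c|) ∧
      ∇ (fun x => f x ^ 2 + c) = fun x => (2 * f x) • ∇ f x := by
  have hc := hf.continuous
  have hc' := hf.continuous_grad
  have hK := hf.nonneg
  refine BddC1.of_hasFDerivAt (fun x => ?_) (by fun_prop) (fun x => ?_) (fun x => ?_)
  · refine (((hf.hasFDerivAt x).pow 2).add_const c).congr_fderiv ?_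
    ext v; simp
  · exact (abs_add_le _ _).trans (by linarith [hf.abs_sq_le x, sq_nonneg K])
  · rw [norm_smul, norm_mul, Real.norm_ofNat, Real.norm_eq_abs]
    nlinarith [mul_le_mul (hf.bound x) (hf.bound_grad x) (norm_nonneg _) hK, abs_nonneg c]

variable {μ : Measure (Space d)} [IsProbabilityMeasure μ]

lemma SubGaussianTails.integrable {σ C : ℝ} (h : SubGaussianTails μ σ C) :
    Integrable (fun p : Space d × Space d => Real.exp (‖p.1 - p.2‖ ^ 2 / σ ^ 2)) (μ.prod μ) ∧
      ∫ p : Space d × Space d, Real.exp (‖p.1 - p.2‖ ^ 2 / σ ^ 2) ∂(μ.prod μ) ≤ C ∧ 1 ≤ C := by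
  have hm : Measurable fun p : Space d × Space d => Real.exp (‖p.1 - p.2‖ ^ 2 / σ ^ 2) := by
    fun_prop
  have hle : ∫⁻ p : Space d × Space d, ENNReal.ofReal (Real.exp (‖p.1 - p.2‖ ^ 2 / σ ^ 2))
      ∂(μ.prod μ) ≤ ENNReal.ofReal C := by
    rw [lintegral_prod _ (by fun_prop)]
    exact h
  have hint : Integrable (fun p : Space d × Space d => Real.exp (‖p.1 - p.2‖ ^ 2 / σ ^ 2))
      (μ.prod μ) :=
    ⟨hm.aestronglyMeasurable, by
      rw [hasFiniteIntegral_iff_ofReal (ae_of_all _ fun p => (Real.exp_pos _).le)]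
      exact hle.trans_lt ENNReal.ofReal_lt_top⟩
  have h1 : 1 ≤ ∫ p : Space d × Space d, Real.exp (‖p.1 - p.2‖ ^ 2 / σ ^ 2) ∂(μ.prod μ) := by
    simpa using integral_mono (integrable_const (μ := μ.prod μ) (1 : ℝ)) hint
      fun p => Real.one_le_exp (by positivity)
  have h2 : ∫ p : Space d × Space d, Real.exp (‖p.1 - p.2‖ ^ 2 / σ ^ 2) ∂(μ.prod μ) ≤ C := by
    rw [← ofReal_integral_eq_lintegral_ofReal hint (ae_of_all _ fun p => (Real.exp_pos _).le)]
      at hle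
    -- `ENNReal.ofReal` truncates at `0`; the degenerate alternative would make an integral that is
    -- at least `1` nonpositive.
    refine (ENNReal.ofReal_le_ofReal_iff' .. |>.1 hle).resolve_right fun h0 => ?_
    linarith
  exact ⟨hint, h2, h1.trans h2⟩

/-- Integrability and size of a fractional power of an exponential. -/
lemma integral_exp_mul_le {α : Type*} [MeasurableSpace α] {ν : Measure α} [IsProbabilityMeasure ν]
    {S : α → ℝ} (hSm : Measurable S) (hS : ∀ x, 0 ≤ S x) {r C : ℝ} (hr0 : 0 ≤ r) (hr1 : r ≤ 1)
    (hC : 0 < C) (hint : Integrable (fun x => Real.exp (S x)) ν)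
    (hle : ∫ x, Real.exp (S x) ∂ν ≤ C) :
    Integrable (fun x => Real.exp (r * S x)) ν ∧ ∫ x, Real.exp (r * S x) ∂ν ≤ C ^ r := by
  have hi : Integrable (fun x => Real.exp (r * S x)) ν := by
    refine hint.mono' (by fun_prop) (ae_of_all _ fun x => ?_)
    rw [Real.norm_of_nonneg (Real.exp_pos _).le, Real.exp_le_exp]
    exact mul_le_of_le_one_left (hS x) hr1
  refine ⟨hi, ?_⟩
  -- The tangent to the concave power `y ↦ y^r` at `y = C`, that is, Bernoulli's inequality.
  have hpt : ∀ x, Real.exp (r * S x) ≤ C ^ r * (1 - r) + C ^ r * r / C * Real.exp (S x) := by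
    intro x
    have h := rpow_one_add_le_one_add_mul_self (s := Real.exp (S x) / C - 1)
      (by linarith [show 0 ≤ Real.exp (S x) / C by positivity]) hr0 hr1
    rw [add_sub_cancel, Real.div_rpow (Real.exp_pos _).le hC.le, ← Real.exp_mul,
      div_le_iff₀ (Real.rpow_pos_of_pos hC r), mul_comm (S x)] at h
    refine h.trans (le_of_eq ?_)
    ring
  have h := integral_mono hi ((integrable_const _).add (hint.const_mul _)) hpt
  rw [integral_add' (integrable_const _) (hint.const_mul _), integral_const, integral_const_mul]
    at h
  simp only [probReal_univ, one_smul] at h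
  have h2 : C ^ r * r / C * ∫ x, Real.exp (S x) ∂ν ≤ C ^ r * r / C * C :=
    mul_le_mul_of_nonneg_left hle (by positivity)
  rw [div_mul_cancel₀ _ hC.ne'] at h2
  linarith

section

variable {σ t C : ℝ} (hσ : 0 < σ) (h : SubGaussianTails μ σ C) (ht : σ ^ 2 < t)
include hσ h ht

lemma SubGaussianTails.poincare_conv {f : Space d → ℝ} {K : ℝ} (hf : BddC1 f K) :
    ∫ x, f x ^ 2 ∂(μ.conv (gaussian d t)) - (∫ x, f x ∂(μ.conv (gaussian d t))) ^ 2 ≤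
      t * C ^ (σ ^ 2 / t) * energy (μ.conv (gaussian d t)) f := by
  have ht0 : 0 < t := (by positivity : 0 < σ ^ 2).trans ht
  obtain ⟨hint, hle, hC1⟩ := h.integrable
  obtain ⟨h1, h2⟩ := integral_exp_mul_le (r := σ ^ 2 / t) (by fun_prop)
    (fun p : Space d × Space d => by positivity) (by positivity) ((div_le_one ht0).2 ht.le)
    (by linarith) hint hle
  have e : ∀ p : Space d × Space d, σ ^ 2 / t * (‖p.1 - p.2‖ ^ 2 / σ ^ 2) =
      ‖p.1 - p.2‖ ^ 2 / t := fun p => by field_simp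
  simp_rw [e] at h1 h2
  refine (GaussConv.poincare_conv μ hf ht0 h1).trans ?_
  refine mul_le_mul_of_nonneg_right ?_ (integral_nonneg fun x => sq_nonneg _)
  exact mul_le_mul_of_nonneg_left h2 ht0.le

/-- Take `F = g² + ε`, for which `‖∇F‖²/F ≤ 4‖∇g‖²`, and let `ε → 0`. -/
lemma SubGaussianTails.defective_log_sobolev_conv {g : Space d → ℝ} {K : ℝ} (hg : BddC1 g K) :
    (1 - σ ^ 2 / t) * ent (μ.conv (gaussian d t)) (fun x => g x ^ 2) ≤
      (2 - σ ^ 2 / t) * (2 * t * energy (μ.conv (gaussian d t)) g) +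
        σ ^ 2 / t * Real.log C * ∫ x, g x ^ 2 ∂(μ.conv (gaussian d t)) := by
  have hσ2 : 0 < σ ^ 2 := by positivity
  have ht0 : 0 < t := hσ2.trans ht
  have hr1 : σ ^ 2 / t < 1 := (div_lt_one ht0).2 ht
  obtain ⟨hint, hle, hC1⟩ := h.integrable
  have hc := hg.continuous
  have hc' := hg.continuous_grad
  have : IsProbabilityMeasure (gaussian d t) := by unfold gaussian; infer_instance
  refine ent_le_of_forall_add (by fun_prop) (fun x => sq_nonneg _) hg.abs_sq_le
    (by linarith) fun ε hε => ?_
  obtain ⟨hb, hgrad⟩ := hg.sq_add_const ε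
  have hpos : ∀ x, 0 < g x ^ 2 + ε := fun x => by positivity
  refine (GaussConv.defective_log_sobolev_conv μ hb hε
    (fun x => by linarith [sq_nonneg (g x)]) hσ2 ht (by linarith) hint hle).trans ?_
  rw [hgrad]
  refine add_le_add_left (mul_le_mul_of_nonneg_left ?_ (by linarith)) _
  have hpt : ∀ x, ‖(2 * g x) • ∇ g x‖ ^ 2 / (g x ^ 2 + ε) ≤ 4 * ‖∇ g x‖ ^ 2 := fun x => by
    rw [div_le_iff₀ (hpos x), norm_smul, mul_pow, Real.norm_eq_abs, sq_abs]
    nlinarith [mul_nonneg (sq_nonneg ‖∇ g x‖) hε.le]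
  have hi : Integrable (fun x => 4 * ‖∇ g x‖ ^ 2) (μ.conv (gaussian d t)) :=
    (integrable_of_continuous_of_bound (by fun_prop) hg.abs_sq_grad_le).const_mul 4
  have hi2 : Integrable (fun x => ‖(2 * g x) • ∇ g x‖ ^ 2 / (g x ^ 2 + ε))
      (μ.conv (gaussian d t)) := by
    refine hi.mono' (Continuous.aestronglyMeasurable ?_) (ae_of_all _ fun x => ?_)
    · exact Continuous.div (by fun_prop) (by fun_prop) fun x => (hpos x).ne'
    · rw [Real.norm_of_nonneg (div_nonneg (sq_nonneg _) (hpos x).le)]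
      exact hpt x
  have := integral_mono hi2 hi hpt
  rw [integral_const_mul] at this
  rw [energy]
  nlinarith

/-- For `g = f - ∫ f`, both the defect and the Rothaus error are multiples of `∫ g²`, which Poincaré
bounds by the energy. -/
lemma SubGaussianTails.log_sobolev_conv {f : Space d → ℝ} {K : ℝ} (hf : BddC1 f K) :
    ent (μ.conv (gaussian d t)) (fun x => f x ^ 2) ≤
      2 * (t * (1 + t / (t - σ ^ 2) + (3 + σ ^ 2 / (t - σ ^ 2) * Real.log C / 2) *
        C ^ (σ ^ 2 / t))) * energy (μ.conv (gaussian d t)) f := by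
  have hσ2 : 0 < σ ^ 2 := by positivity
  have ht0 : 0 < t := hσ2.trans ht
  have hts : 0 < t - σ ^ 2 := by linarith
  obtain ⟨-, -, hC1⟩ := h.integrable
  have hc := hf.continuous
  have : IsProbabilityMeasure (gaussian d t) := by unfold gaussian; infer_instance
  set ρ := μ.conv (gaussian d t)
  set c := ∫ x, f x ∂ρ with hcdef
  obtain ⟨hg, hgrad⟩ := hf.sub_const c
  have i1 : Integrable f ρ := integrable_of_continuous_of_bound hc hf.bound
  have i2 : Integrable (fun x => f x ^ 2) ρ :=
    integrable_of_continuous_of_bound (by fun_prop) hf.abs_sq_le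
  have h0 : ∫ x, f x - c ∂ρ = 0 := by
    rw [integral_sub i1 (integrable_const _)]; simp [hcdef]
  have hE : energy ρ (fun x => f x - c) = energy ρ f := by rw [energy, hgrad, energy]
  have r1 := ent_sq_const_add_le hg.continuous hg.bound h0 c
  simp only [add_sub_cancel] at r1
  have r2 := h.defective_log_sobolev_conv hσ ht hg
  rw [hE] at r2
  have r3 := h.poincare_conv hσ ht hf
  have r4 := integral_sub_const_sq i1 i2 c
  rw [← hcdef] at r3 r4
  set V := ∫ x, (f x - c) ^ 2 ∂ρ
  set D := energy ρ f
  set Q := C ^ (σ ^ 2 / t)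
  have r5 : V ≤ t * Q * D := by linarith
  have e1 : 1 - σ ^ 2 / t = (t - σ ^ 2) / t := by field_simp
  -- Division by `1 - r`, `r = σ²/t`: `(2-r)/(1-r) = 1 + t/(t-σ²)` and `r/(1-r) = σ²/(t-σ²)`.
  have r6 : ent ρ (fun x => (f x - c) ^ 2) ≤ (1 + t / (t - σ ^ 2)) * (2 * t * D) +
      σ ^ 2 / (t - σ ^ 2) * Real.log C * V := by
    have hq : 0 < (t - σ ^ 2) / t := by positivity
    refine le_of_mul_le_mul_left ?_ hq
    rw [e1] at r2
    refine r2.trans (le_of_eq ?_)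
    field_simp
    ring
  have hL : 0 ≤ σ ^ 2 / (t - σ ^ 2) * Real.log C :=
    mul_nonneg (by positivity) (Real.log_nonneg hC1)
  have r7 := mul_le_mul_of_nonneg_left r5 (by linarith : 0 ≤ σ ^ 2 / (t - σ ^ 2) * Real.log C + 6)
  calc _ ≤ (1 + t / (t - σ ^ 2)) * (2 * t * D) + σ ^ 2 / (t - σ ^ 2) * Real.log C * V + 6 * V := by
        linarith
    _ ≤ (1 + t / (t - σ ^ 2)) * (2 * t * D) +
        (σ ^ 2 / (t - σ ^ 2) * Real.log C + 6) * (t * Q * D) := by linarith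
    _ = _ := by ring

end

lemma energy_nonneg (ρ : Measure (Space d)) (f : Space d → ℝ) : 0 ≤ energy ρ f :=
  integral_nonneg fun _ => sq_nonneg _

lemma poincareConst_le {ρ : Measure (Space d)} {C : ℝ} (hC : 0 ≤ C) (h : PI ρ C) :
    poincareConst ρ ≤ ENNReal.ofReal C :=
  iInf₂_le (f := fun (C : ℝ≥0) (_ : PI ρ C) => (C : ℝ≥0∞)) C.toNNReal
    (by rwa [Real.coe_toNNReal C hC])

lemma logSobolevConst_le {ρ : Measure (Space d)} {C : ℝ} (hC : 0 ≤ C) (h : LSI ρ C) :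
    logSobolevConst ρ ≤ ENNReal.ofReal C :=
  iInf₂_le (f := fun (C : ℝ≥0) (_ : LSI ρ C) => (C : ℝ≥0∞)) C.toNNReal
    (by rwa [Real.coe_toNNReal C hC])

end Conclusion

end GaussConv

theorem theorem4p5 (d : ℕ) (μ : MeasureTheory.Measure (GaussConv.Space d))
    [MeasureTheory.IsProbabilityMeasure μ] (σ t CSG : ℝ) (hσ : 0 < σ)
    (hμ : GaussConv.SubGaussianTails μ σ CSG) (ht : σ ^ 2 < t) :
    ((∃ C : ℝ, GaussConv.PI (μ.conv (GaussConv.gaussian d t)) C) ∧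
      (∃ C : ℝ, GaussConv.LSI (μ.conv (GaussConv.gaussian d t)) C)) ∧
    GaussConv.poincareConst (μ.conv (GaussConv.gaussian d t)) ≤
      ENNReal.ofReal (t * (t / (t - σ ^ 2) + CSG ^ (σ ^ 2 / (t - σ ^ 2)))) ∧
    GaussConv.logSobolevConst (μ.conv (GaussConv.gaussian d t)) ≤
      ENNReal.ofReal (3 * t * (t / (t - σ ^ 2) + CSG ^ (σ ^ 2 / (t - σ ^ 2))) *
        (1 + σ ^ 2 / (t - σ ^ 2) * Real.log CSG)) := by
  have hσ2 : 0 < σ ^ 2 := by positivity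
  have ht0 : 0 < t := hσ2.trans ht
  have hts : 0 < t - σ ^ 2 := by linarith
  obtain ⟨-, -, hC1⟩ := hμ.integrable
  have : IsProbabilityMeasure (GaussConv.gaussian d t) := by
    unfold GaussConv.gaussian; infer_instance
  have hp : 1 ≤ t / (t - σ ^ 2) := (one_le_div hts).2 (by linarith)
  have hL : 0 ≤ σ ^ 2 / (t - σ ^ 2) * Real.log CSG :=
    mul_nonneg (by positivity) (Real.log_nonneg hC1)
  have hQ0 : 0 ≤ CSG ^ (σ ^ 2 / t) := Real.rpow_nonneg (by linarith) _
  -- The argument gives the smaller exponent `σ²/t`; as `CSG ≥ 1`, it may be relaxed to the stated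
  -- one.
  have hQ : CSG ^ (σ ^ 2 / t) ≤ CSG ^ (σ ^ 2 / (t - σ ^ 2)) :=
    Real.rpow_le_rpow_of_exponent_le hC1 (div_le_div_of_nonneg_left hσ2.le hts (by linarith))
  set p := t / (t - σ ^ 2)
  set L := σ ^ 2 / (t - σ ^ 2) * Real.log CSG
  set Q := CSG ^ (σ ^ 2 / (t - σ ^ 2))
  set M := CSG ^ (σ ^ 2 / t)
  have hPI : GaussConv.PI (μ.conv (GaussConv.gaussian d t)) (t * (p + Q)) := by
    intro f hf
    obtain ⟨K, hK⟩ := hf.exists_bddC1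
    have hc := hK.continuous
    rw [variance_eq_sub (MemLp.of_bound hc.aestronglyMeasurable K (ae_of_all _ hK.bound))]
    refine (hμ.poincare_conv hσ ht hK).trans
      (mul_le_mul_of_nonneg_right ?_ (GaussConv.energy_nonneg _ _))
    exact mul_le_mul_of_nonneg_left (by linarith) ht0.le
  have hLSI : GaussConv.LSI (μ.conv (GaussConv.gaussian d t)) (3 * t * (p + Q) * (1 + L)) := by
    intro f hf
    obtain ⟨K, hK⟩ := hf.exists_bddC1
    refine (hμ.log_sobolev_conv hσ ht hK).trans
      (mul_le_mul_of_nonneg_right ?_ (GaussConv.energy_nonneg _ _))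
    -- Here `1 ≤ p` absorbs the lone `1`, and the factor `3` matches the coefficient of `M` (half
    -- the Rothaus `6`).
    have h1 : 1 + p + (3 + L / 2) * M ≤ 3 * (p + Q) * (1 + L) := by
      have h2 : (3 + L / 2) * M ≤ (3 + L / 2) * Q := mul_le_mul_of_nonneg_left hQ (by linarith)
      nlinarith [mul_nonneg hL (hQ0.trans hQ), mul_nonneg hL (zero_le_one.trans hp)]
    calc _ ≤ 2 * (t * (3 * (p + Q) * (1 + L))) := by gcongr
      _ = _ := by ring
  have hQ' : 0 ≤ Q := hQ0.trans hQ
  have hp' : 0 ≤ p := zero_le_one.trans hp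
  exact ⟨⟨⟨_, hPI⟩, ⟨_, hLSI⟩⟩, GaussConv.poincareConst_le (by positivity) hPI,
    GaussConv.logSobolevConst_le (by positivity) hLSI⟩
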